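/- Let $\mathbb{G}=(\mathbb{R}^n,\cdot)$ be a Carnot group in exponential coordinates: the group law is $x\cdot y=x+y+P(x,y)$ with $P$ polynomial, $0$ is the neutral element and $x^{-1}=-x$; the coordinates carry integer weights $\alpha_i\ge 1$, the components of $P$ of weight $1$ vanish, the dilations $\delta_\lambda(x)=(\lambda^{\alpha_1}x_1,\dots,\lambda^{\alpha_n}x_n)$, $\lambda>0$, are group automorphisms, and, with $V_i$ the span of the left invariant vector fields that equal $\partial_j$ at $0$ for some $j$ with $\alpha_j=i$, the Lie algebra is stratified: $[V_1,V_i]=V_{i+1}$ for all $i\ge 1$ (with $V_i=0$ for $i$ larger than all weights). Let $Q=\sum_i i\dim V_i$ be the homogeneous dimension and assume $Q\ge 3$. Let $X_j$, for $j$ with $\alpha_j=1$, be the left invariant vector fields with $X_j(0)=\partial_j$, and put $\nabla_{\mathbb{G}}=(X_j)_j$ and $\Delta_{\mathbb{G}}=\sum_j X_j^2$. A homogeneous norm is a continuous function $\mathbb{G}\to[0,\infty)$, smooth on $\mathbb{G}\setminus\{0\}$, vanishing exactly at $0$, invariant under $x\mapsto x^{-1}$, and homogeneous of degree one under the dilations.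 Let $u$ be Folland's fundamental solution of $-\Delta_{\mathbb{G}}$, that is, the locally integrable function with $-\Delta_{\mathbb{G}}u=\delta_0$ in the sense of distributions that on $\mathbb{G}\setminus\{0\}$ has the form $M^{2-Q}$ with $M$ a homogeneous norm. Let $N=u^{1/(2-Q)}$ on $\mathbb{G}\setminus\{0\}$ and $N(0)=0$. Assume that $\mathbb{G}$ is polarizable, that is, $$\tfrac12\big\langle\nabla_{\mathbb{G}}(|\nabla_{\mathbb{G}}N|^2),\nabla_{\mathbb{G}}N\big\rangle=0\quad\text{in }\mathbb{G}\setminus\{0\}.$$ Let $1<p<Q$. Then for every real-valued $\phi\in C_0^\infty(\mathbb{G}\setminus\{0\})$ the two integrals below (with respect to Lebesgue measure) are finite and $$\int_{\mathbb{G}}|\nabla_{\mathbb{G}}\phi|^p\,dx\ \ge\ \Big(\frac{Q-p}{p}\Big)^p\int_{\mathbb{G}}\frac{|\nabla_{\mathbb{G}}N|^p}{N^p}|\phi|^p\,dx .$$ Moreover the constant is sharp: if $C\in\mathbb{R}$ is such that $\int_{\mathbb{G}}|\nabla_{\mathbb{G}}\phi|^p\,dx\ge C\int_{\mathbb{G}}\frac{|\nabla_{\mathbb{G}}N|^p}{N^p}|\phi|^p\,dx$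 for every $\phi\in C_0^\infty(\mathbb{G}\setminus\{0\})$, then $C\le\big(\frac{Q-p}{p}\big)^p$. -/

import Mathlib

open MeasureTheory Set
open scoped ContDiff

noncomputable section

/-- Anisotropic dilation of `ℝⁿ`: `δ_r (x₁, …, xₙ) = (r^{α₁} x₁, …, r^{αₙ} xₙ)`. -/
def anisotropicDilation {n : ℕ} (α : Fin n → ℕ) (r : ℝ) (x : Fin n → ℝ) : Fin n → ℝ :=
  fun i => r ^ α i * x i

/-- The vector field on `ℝⁿ` with value `v` at `0` that is invariant under the left translations
of the law `mul`: its value at `x` is the image of `v` under the differential at `0` of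
`y ↦ x · y`. -/
def leftInvariantField {n : ℕ} (mul : (Fin n → ℝ) → (Fin n → ℝ) → (Fin n → ℝ))
    (v : Fin n → ℝ) (x : Fin n → ℝ) : Fin n → ℝ :=
  fderiv ℝ (fun y => mul x y) 0 v

/-- The bracket of the Lie algebra of `(ℝⁿ, mul)`, transported to the tangent space `ℝⁿ` at `0`
through the identification of a left invariant field with its value at `0`. -/
def tangentBracket {n : ℕ} (mul : (Fin n → ℝ) → (Fin n → ℝ) → (Fin n → ℝ))
    (v w : Fin n → ℝ) : Fin n → ℝ :=
  VectorField.lieBracket ℝ (leftInvariantField mul v) (leftInvariantField mul w) 0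

/-- The span `V_i` of the coordinate directions of weight `i`. -/
def weightLayer {n : ℕ} (α : Fin n → ℕ) (i : ℕ) : Submodule ℝ (Fin n → ℝ) :=
  Submodule.span ℝ {v | ∃ j, α j = i ∧ v = Pi.single j 1}

/-- A Carnot group `(ℝⁿ, ·)` in exponential coordinates: a polynomial group law
`x · y = x + y + P(x, y)` with neutral element `0` and inverse `-x`, for which the dilations are
automorphisms, and whose Lie algebra is stratified by the layers `V_i` of the coordinates of
weight `i`.  As all weights are positive, `ℝⁿ` is the direct sum of `V_1, …, V_k`, where `k` is the
largest weight; as `V_i = 0` for `i > k`, the field `stratified` says that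
`[V_1, V_i] = V_{i+1}` for `1 ≤ i < k` and `[V_1, V_k] = 0`. -/
structure CarnotGroup (n : ℕ) where
  /-- The weights `α₁, …, αₙ` of the coordinates. -/
  weight : Fin n → ℕ
  /-- The group law. -/
  mul : (Fin n → ℝ) → (Fin n → ℝ) → (Fin n → ℝ)
  one_le_weight : ∀ i, 1 ≤ weight i
  mul_assoc : ∀ x y z, mul (mul x y) z = mul x (mul y z)
  zero_mul : ∀ x, mul 0 x = x
  mul_zero : ∀ x, mul x 0 = x
  neg_mul_cancel : ∀ x, mul (-x) x = 0
  mul_neg_cancel : ∀ x, mul x (-x) = 0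
  polynomial_law : ∀ i, ∃ P : MvPolynomial (Fin n ⊕ Fin n) ℝ,
    ∀ x y, mul x y i = x i + y i + MvPolynomial.eval (Sum.elim x y) P
  mul_horizontal : ∀ i, weight i = 1 → ∀ x y, mul x y i = x i + y i
  dilation_mul : ∀ r : ℝ, 0 < r → ∀ x y,
    mul (anisotropicDilation weight r x) (anisotropicDilation weight r y) =
      anisotropicDilation weight r (mul x y)
  stratified : ∀ i, 1 ≤ i →
    Submodule.span ℝ {z | ∃ v ∈ weightLayer weight 1, ∃ w ∈ weightLayer weight i,
      z = tangentBracket mul v w} = weightLayer weight (i + 1)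

namespace CarnotGroup

variable {n : ℕ} (G : CarnotGroup n)

/-- The homogeneous dimension `Q = ∑ j (dim V_j)`: each coordinate of weight `j` contributes `j`. -/
def homDim : ℕ := ∑ i, G.weight i

/-- The dilation `δ_r`. -/
def dilation (r : ℝ) (x : Fin n → ℝ) : Fin n → ℝ := anisotropicDilation G.weight r x

/-- The indices of the first layer `V_1`. -/
def horizontal : Finset (Fin n) := Finset.univ.filter fun j => G.weight j = 1

/-- The derivative `X_j f`, where `X_j` is the left invariant vector field with
`X_j(0) = ∂_j`. -/
def X (j : Fin n) (f : (Fin n → ℝ) → ℝ) (x : Fin n → ℝ) : ℝ :=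
  fderiv ℝ f x (leftInvariantField G.mul (Pi.single j 1) x)

/-- The inner product `⟨∇_G f, ∇_G g⟩` of horizontal gradients, `∇_G = (X_j)_{j horizontal}`. -/
def gradInner (f g : (Fin n → ℝ) → ℝ) (x : Fin n → ℝ) : ℝ :=
  ∑ j ∈ G.horizontal, G.X j f x * G.X j g x

/-- The length `|∇_G f|` of the horizontal gradient. -/
def gradNorm (f : (Fin n → ℝ) → ℝ) (x : Fin n → ℝ) : ℝ :=
  Real.sqrt (∑ j ∈ G.horizontal, G.X j f x ^ 2)

/-- The sub-Laplacian `Δ_G = ∑ X_j²`. -/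
def subLaplacian (f : (Fin n → ℝ) → ℝ) (x : Fin n → ℝ) : ℝ :=
  ∑ j ∈ G.horizontal, G.X j (G.X j f) x

/-- The `∞`-sub-Laplacian `Δ_{G,∞} f = ½ ⟨∇_G (|∇_G f|²), ∇_G f⟩`. -/
def infSubLaplacian (f : (Fin n → ℝ) → ℝ) (x : Fin n → ℝ) : ℝ :=
  1 / 2 * G.gradInner (fun y => G.gradNorm f y ^ 2) f x

/-- Homogeneous norms: continuous, nonnegative, smooth away from `0`, homogeneous of degree one,
symmetric under `x ↦ x⁻¹ = -x`, and vanishing only at `0`. -/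
structure IsHomogeneousNorm (N : (Fin n → ℝ) → ℝ) : Prop where
  continuous : Continuous N
  nonneg : ∀ x, 0 ≤ N x
  smooth : ContDiffOn ℝ ∞ N {0}ᶜ
  dilation : ∀ r : ℝ, 0 < r → ∀ x, N (G.dilation r x) = r * N x
  inv : ∀ x, N (-x) = N x
  eq_zero_iff : ∀ x, N x = 0 ↔ x = 0

/-- `-Δ_G u = δ_0` in the sense of distributions.  (`Δ_G` is formally self-adjoint for Lebesgue
measure, which is the Haar measure of the group.) -/
structure IsFundamentalSolution (u : (Fin n → ℝ) → ℝ) : Prop where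
  locallyIntegrable : LocallyIntegrable u
  weak_eq : ∀ f : (Fin n → ℝ) → ℝ, ContDiff ℝ ∞ f → HasCompactSupport f →
    -∫ x, u x * G.subLaplacian f x = f 0

/-- Folland's solution: the fundamental solution of the form `u = N^{2-Q}` away from the origin,
with `N` a homogeneous norm. -/
structure IsFollandSolution (u : (Fin n → ℝ) → ℝ) : Prop where
  fundamental : G.IsFundamentalSolution u
  eq_norm_rpow : ∃ N : (Fin n → ℝ) → ℝ, G.IsHomogeneousNorm N ∧
    ∀ x, x ≠ 0 → u x = N x ^ (2 - (G.homDim : ℝ))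

/-- The gauge of `u`: `u^{1/(2-Q)}` away from the origin and `0` at the origin. -/
def gauge (u : (Fin n → ℝ) → ℝ) (x : Fin n → ℝ) : ℝ :=
  open Classical in if x = 0 then 0 else u x ^ (1 / (2 - (G.homDim : ℝ)))

/-- `G` is polarizable if the gauge of Folland's solution is `∞`-harmonic away from the origin. -/
def IsPolarizable : Prop :=
  ∀ u : (Fin n → ℝ) → ℝ, G.IsFollandSolution u →
    ∀ x, x ≠ 0 → G.infSubLaplacian (G.gauge u) x = 0

end CarnotGroup

/-- `C_0^∞(ℝⁿ ∖ {0})`: smooth functions with compact support contained in `ℝⁿ ∖ {0}`. -/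
structure IsPuncturedTestFunction {n : ℕ} (φ : (Fin n → ℝ) → ℝ) : Prop where
  smooth : ContDiff ℝ ∞ φ
  compact : HasCompactSupport φ
  support : tsupport φ ⊆ {0}ᶜ

end

/-!
The function `u = N^{2-Q}` is harmonic away from `0`, which says that `N Δ N = (Q - 1) |∇N|²`.  As
`N` is moreover `∞`-harmonic, `|∇N|²` is constant along `∇N`, so that for every `h`
`div (h(|∇N|²) N^{1-p} ∇N) = (Q - p) h(|∇N|²) |∇N|² N^{-p}`.
Integrate this against `|φ|^p`, let `h(s)` tend to `s^{(p-2)/2}` (which is singular at the zeros of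
`∇N` if `p < 2`) and apply Young's inequality to the resulting
`(Q - p)/p ∫ |∇N|^p N^{-p} |φ|^p ≤ ∫ (|∇N| N^{-1} |φ|)^{p-1} |∇φ|`.

For sharpness, the density `|∇N|^p N^{-Q}` is invariant under dilations, so its image under `log N`
is invariant under translations and hence is `c` times Lebesgue measure.  Here `c > 0`: if `∇N`
vanished identically, then testing `-Δu = δ₀` with a cutoff function of `N` would give `0 = 1`.
For `φ = N^{-a} g(log N)` with `a = (Q - p)/p` the inequality becomes
`C ∫ |g|^p ≤ ∫ |g' - a g|^p`, and stretching `g` gives `C ≤ a^p`.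
-/

open Filter Topology

section SupportedProduct

variable {E : Type*} [NormedAddCommGroup E] [NormedSpace ℝ E] {U : Set E} {f ψ : E → ℝ}

lemma contDiff_mul_of_tsupport_subset {m : WithTop ℕ∞} (hU : IsOpen U) (hf : ContDiffOn ℝ m f U)
    (hψ : ContDiff ℝ m ψ) (hs : tsupport ψ ⊆ U) : ContDiff ℝ m fun x => f x * ψ x := by
  refine contDiff_iff_contDiffAt.2 fun x => ?_
  by_cases hx : x ∈ tsupport ψ
  · exact (hf.contDiffAt (hU.mem_nhds (hs hx))).mul hψ.contDiffAt
  · refine (contDiffAt_const (c := (0 : ℝ))).congr_of_eventuallyEq ?_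
    filter_upwards [notMem_tsupport_iff_eventuallyEq.1 hx] with y hy
    simp [hy]

lemma continuous_mul_of_tsupport_subset (hU : IsOpen U) (hf : ContinuousOn f U)
    (hψ : Continuous ψ) (hs : tsupport ψ ⊆ U) : Continuous fun x => f x * ψ x :=
  contDiff_zero.1 <|
    contDiff_mul_of_tsupport_subset hU (contDiffOn_zero.2 hf) (contDiff_zero.2 hψ) hs

lemma integrable_mul_of_tsupport_subset [MeasurableSpace E] [OpensMeasurableSpace E]
    {μ : Measure E} [IsFiniteMeasureOnCompacts μ] (hU : IsOpen U) (hf : ContinuousOn f U)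
    (hψ : Continuous ψ) (hc : HasCompactSupport ψ) (hs : tsupport ψ ⊆ U) :
    Integrable (fun x => f x * ψ x) μ :=
  (continuous_mul_of_tsupport_subset hU hf hψ hs).integrable_of_hasCompactSupport hc.mul_left

end SupportedProduct

/-! ### Dilations and left invariant fields -/

namespace CarnotGroup

variable {n : ℕ} (G : CarnotGroup n)

/-- The dilation `δ_r` as a continuous linear map. -/
noncomputable def dilationCLM (r : ℝ) : (Fin n → ℝ) →L[ℝ] (Fin n → ℝ) :=
  .pi fun i => r ^ G.weight i • .proj i

lemma dilation_apply (r : ℝ) (x : Fin n → ℝ) (i : Fin n) :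
    G.dilation r x i = r ^ G.weight i * x i := rfl

lemma dilation_zero_left (x : Fin n → ℝ) : G.dilation 0 x = 0 := by
  funext i
  simp [dilation_apply, (Nat.one_le_iff_ne_zero.1 (G.one_le_weight i))]

lemma dilation_one (x : Fin n → ℝ) : G.dilation 1 x = x := by
  funext i
  simp [dilation_apply]

lemma dilation_dilation (r s : ℝ) (x : Fin n → ℝ) :
    G.dilation r (G.dilation s x) = G.dilation (r * s) x := by
  funext i
  simp [dilation_apply, mul_pow, _root_.mul_assoc]

lemma dilation_ne_zero {r : ℝ} (hr : 0 < r) {x : Fin n → ℝ} (hx : x ≠ 0) :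
    G.dilation r x ≠ 0 := fun h => hx <| by
  rw [← G.dilation_one x, ← inv_mul_cancel₀ hr.ne', ← dilation_dilation, h]
  exact map_zero (G.dilationCLM r⁻¹)

lemma dilation_single (r : ℝ) (j : Fin n) :
    G.dilation r (Pi.single j 1) = r ^ G.weight j • Pi.single j (1 : ℝ) := by
  funext i
  by_cases h : i = j
  · subst h; simp [dilation_apply]
  · simp [dilation_apply, h]

lemma continuous_dilation_left (x : Fin n → ℝ) : Continuous fun r => G.dilation r x := by
  unfold dilation anisotropicDilation
  fun_prop

lemma continuous_dilation (r : ℝ) : Continuous (G.dilation r) := (G.dilationCLM r).continuous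

lemma hasFDerivAt_dilation (r : ℝ) (x : Fin n → ℝ) :
    HasFDerivAt (G.dilation r) (G.dilationCLM r) x := (G.dilationCLM r).hasFDerivAt

lemma eq_zero_of_pow_mul_comp_dilation {c : (Fin n → ℝ) → ℝ} (hc : ContinuousAt c 0) {m : ℕ}
    (hm : m ≠ 0) {x : Fin n → ℝ} (h : ∀ r > 0, r ^ m * c (G.dilation r x) = c x) : c x = 0 := by
  have hpow : Tendsto (fun r : ℝ => r ^ m) (𝓝 0) (𝓝 0) := by
    simpa [hm] using (continuous_pow (M := ℝ) m).tendsto 0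
  have hdil : Tendsto (fun r => G.dilation r x) (𝓝 0) (𝓝 0) := by
    simpa [dilation_zero_left] using (G.continuous_dilation_left x).tendsto 0
  have hlim : Tendsto (fun r : ℝ => r ^ m * c (G.dilation r x)) (𝓝[>] 0) (𝓝 0) := by
    simpa using (hpow.mul (hc.tendsto.comp hdil)).mono_left nhdsWithin_le_nhds
  refine tendsto_nhds_unique (tendsto_const_nhds.congr' ?_) hlim
  filter_upwards [self_mem_nhdsWithin] with r hr using (h r hr).symm

lemma fderiv_comp_dilation {f : (Fin n → ℝ) → ℝ} {r : ℝ} {x : Fin n → ℝ}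
    (hf : DifferentiableAt ℝ f (G.dilation r x)) (v : Fin n → ℝ) :
    fderiv ℝ (fun y => f (G.dilation r y)) x v =
      fderiv ℝ f (G.dilation r x) (G.dilation r v) :=
  congrArg (· v) (hf.hasFDerivAt.comp x (G.hasFDerivAt_dilation r x)).fderiv

lemma contDiff_mul : ContDiff ℝ ∞ fun z : (Fin n → ℝ) × (Fin n → ℝ) => G.mul z.1 z.2 := by
  refine contDiff_pi.2 fun i => ?_
  obtain ⟨P, hP⟩ := G.polynomial_law i
  let coord : Fin n ⊕ Fin n → (Fin n → ℝ) × (Fin n → ℝ) →L[ℝ] ℝ :=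
    Sum.elim (fun k => .comp (.proj k) (.fst ℝ _ _)) fun k => .comp (.proj k) (.snd ℝ _ _)
  have hcoord (z : (Fin n → ℝ) × (Fin n → ℝ)) : (coord · z) = Sum.elim z.1 z.2 := by
    funext k
    cases k <;> rfl
  have hPsmooth : ContDiff ℝ ∞ fun z : (Fin n → ℝ) × (Fin n → ℝ) =>
      MvPolynomial.eval (Sum.elim z.1 z.2) P := by
    simpa only [hcoord] using (AnalyticOnNhd.eval_continuousLinearMap' (𝕜 := ℝ) coord P).contDiff
  simp only [hP]
  exact ContDiff.add (by fun_prop) hPsmooth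

lemma differentiable_mul_left (x : Fin n → ℝ) : Differentiable ℝ fun y => G.mul x y :=
  (G.contDiff_mul.comp (contDiff_prodMk_right x)).differentiable (by simp)

lemma contDiff_leftInvariantField (v : Fin n → ℝ) : ContDiff ℝ ∞ (leftInvariantField G.mul v) :=
  (ContDiff.fderiv (f := G.mul) (g := fun _ => 0) (m := ∞) G.contDiff_mul contDiff_const
    (by simp)).clm_apply contDiff_const

lemma dilation_leftInvariantField {r : ℝ} (hr : 0 < r) (v x : Fin n → ℝ) :
    G.dilation r (leftInvariantField G.mul v x) =
      leftInvariantField G.mul (G.dilation r v) (G.dilation r x) := by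
  have hleft : HasFDerivAt (fun y => G.dilation r (G.mul x y))
      ((G.dilationCLM r).comp (fderiv ℝ (fun y => G.mul x y) 0)) 0 :=
    (G.hasFDerivAt_dilation r _).comp 0 (G.differentiable_mul_left x 0).hasFDerivAt
  have hright : HasFDerivAt (fun y => G.mul (G.dilation r x) (G.dilation r y))
      ((fderiv ℝ (fun y => G.mul (G.dilation r x) y) (G.dilationCLM r 0)).comp (G.dilationCLM r))
      0 :=
    (G.differentiable_mul_left (G.dilation r x) _).hasFDerivAt.comp 0
      (G.hasFDerivAt_dilation r 0)
  have hmul : (fun y => G.mul (G.dilation r x) (G.dilation r y)) =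
      fun y => G.dilation r (G.mul x y) := funext fun y => G.dilation_mul r hr x y
  rw [hmul, map_zero] at hright
  exact congrArg (· v) (hleft.unique hright)

lemma dilation_leftInvariantField_single {r : ℝ} (hr : 0 < r) (j : Fin n) (x : Fin n → ℝ) :
    G.dilation r (leftInvariantField G.mul (Pi.single j 1) x) =
      r ^ G.weight j • leftInvariantField G.mul (Pi.single j 1) (G.dilation r x) := by
  rw [dilation_leftInvariantField G hr, dilation_single]
  simp [leftInvariantField]

-- `X_j` is homogeneous of degree `α_j`, so the derivative along `x_k` of its `k`-th coefficient
-- is homogeneous of the negative degree `-α_j`.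
lemma fderiv_leftInvariantField_diag (j k : Fin n) (x : Fin n → ℝ) :
    fderiv ℝ (fun y => leftInvariantField G.mul (Pi.single j 1) y k) x (Pi.single k 1) = 0 := by
  set a : (Fin n → ℝ) → ℝ := fun y => leftInvariantField G.mul (Pi.single j 1) y k
  have ha : ContDiff ℝ ∞ a := contDiff_pi.1 (G.contDiff_leftInvariantField _) k
  have hda : Differentiable ℝ a := ha.differentiable (by simp)
  refine G.eq_zero_of_pow_mul_comp_dilation (c := fun y => fderiv ℝ a y (Pi.single k 1))
    ((ha.continuous_fderiv (by simp)).clm_apply continuous_const).continuousAt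
    (Nat.one_le_iff_ne_zero.1 (G.one_le_weight j)) fun r hr => ?_
  have hhom : (fun y => r ^ G.weight j * a (G.dilation r y)) = fun y => r ^ G.weight k * a y :=
    funext fun y => (congrFun (G.dilation_leftInvariantField_single hr j y) k).symm
  have hderiv := congrArg (fun f => fderiv ℝ f x (Pi.single k 1)) hhom
  have hcomp : DifferentiableAt ℝ (fun y => a (G.dilation r y)) x :=
    (hda _).comp x (G.hasFDerivAt_dilation r x).differentiableAt
  simp only [fderiv_const_mul hcomp, fderiv_const_mul (hda x), smul_apply,
    G.fderiv_comp_dilation (hda _), dilation_single, map_smul, smul_eq_mul] at hderiv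
  have hrk : r ^ G.weight k ≠ 0 := (pow_pos hr _).ne'
  refine mul_left_cancel₀ hrk ?_
  rw [← hderiv]
  ring

end CarnotGroup

/-! ### Horizontal derivatives and integration by parts -/

namespace CarnotGroup

variable {n : ℕ} {G : CarnotGroup n} {U : Set (Fin n → ℝ)} {f g k ψ : (Fin n → ℝ) → ℝ}
  {x : Fin n → ℝ}

lemma X_eq_sum (j : Fin n) (f : (Fin n → ℝ) → ℝ) (x : Fin n → ℝ) :
    G.X j f x = ∑ k, leftInvariantField G.mul (Pi.single j 1) x k *
      fderiv ℝ f x (Pi.single k 1) := by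
  rw [X]
  conv_lhs => rw [pi_eq_sum_univ' (leftInvariantField G.mul (Pi.single j 1) x), map_sum]
  simp only [map_smul, smul_eq_mul]

lemma X_mul (j : Fin n) (hf : DifferentiableAt ℝ f x) (hg : DifferentiableAt ℝ g x) :
    G.X j (fun y => f y * g y) x = f x * G.X j g x + G.X j f x * g x := by
  simp [X, fderiv_fun_mul hf hg, mul_comm]

lemma X_comp (j : Fin n) {h : ℝ → ℝ} {h' : ℝ} (hh : HasDerivAt h h' (f x))
    (hf : DifferentiableAt ℝ f x) : G.X j (fun y => h (f y)) x = h' * G.X j f x :=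
  congrArg (· (leftInvariantField G.mul (Pi.single j 1) x))
    (hh.comp_hasFDerivAt x hf.hasFDerivAt).fderiv

lemma X_congr (j : Fin n) (h : f =ᶠ[𝓝 x] g) : G.X j f x = G.X j g x := by
  simp [X, h.fderiv_eq]

lemma X_comp_dilation (j : Fin n) {r : ℝ} (hr : 0 < r)
    (hf : DifferentiableAt ℝ f (G.dilation r x)) :
    G.X j (fun y => f (G.dilation r y)) x = r ^ G.weight j * G.X j f (G.dilation r x) := by
  rw [X, G.fderiv_comp_dilation hf, G.dilation_leftInvariantField_single hr, map_smul,
    smul_eq_mul, X]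

lemma contDiffOn_X (j : Fin n) (hU : IsOpen U) (hf : ContDiffOn ℝ ∞ f U) :
    ContDiffOn ℝ ∞ (G.X j f) U :=
  (hf.fderiv_of_isOpen hU (by simp)).clm_apply (G.contDiff_leftInvariantField _).contDiffOn

lemma differentiableAt_X (j : Fin n) (hU : IsOpen U) (hf : ContDiffOn ℝ ∞ f U) (hx : x ∈ U) :
    DifferentiableAt ℝ (G.X j f) x :=
  ((contDiffOn_X j hU hf).contDiffAt (hU.mem_nhds hx)).differentiableAt (by simp)

lemma contDiff_X (j : Fin n) (hf : ContDiff ℝ ∞ f) : ContDiff ℝ ∞ (G.X j f) :=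
  contDiffOn_univ.1 (contDiffOn_X j isOpen_univ hf.contDiffOn)

lemma continuous_X (j : Fin n) (hf : ContDiff ℝ 1 f) : Continuous (G.X j f) :=
  (hf.continuous_fderiv (by simp)).clm_apply (G.contDiff_leftInvariantField _).continuous

lemma X_eq_zero_of_notMem_tsupport (j : Fin n) (hx : x ∉ tsupport f) : G.X j f x = 0 := by
  have h : f =ᶠ[𝓝 x] fun _ => 0 := notMem_tsupport_iff_eventuallyEq.1 hx
  rw [X_congr j h]
  simp [X]

lemma tsupport_X_subset (j : Fin n) (f : (Fin n → ℝ) → ℝ) : tsupport (G.X j f) ⊆ tsupport f :=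
  closure_minimal (fun _ hx => of_not_not fun h => hx (X_eq_zero_of_notMem_tsupport j h))
    (isClosed_tsupport f)

lemma hasCompactSupport_X (j : Fin n) (hf : HasCompactSupport f) :
    HasCompactSupport (G.X j f) :=
  hf.of_isClosed_subset (isClosed_tsupport _) (tsupport_X_subset j f)

lemma gradNorm_sq (f : (Fin n → ℝ) → ℝ) (x : Fin n → ℝ) :
    G.gradNorm f x ^ 2 = ∑ j ∈ G.horizontal, G.X j f x ^ 2 :=
  Real.sq_sqrt (Finset.sum_nonneg fun _ _ => sq_nonneg _)

lemma gradNorm_nonneg (f : (Fin n → ℝ) → ℝ) (x : Fin n → ℝ) : 0 ≤ G.gradNorm f x :=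
  Real.sqrt_nonneg _

lemma gradNorm_eq_zero_iff : G.gradNorm f x = 0 ↔ ∀ j ∈ G.horizontal, G.X j f x = 0 := by
  rw [← sq_eq_zero_iff, gradNorm_sq, Finset.sum_eq_zero_iff_of_nonneg fun _ _ => sq_nonneg _]
  simp only [sq_eq_zero_iff]

lemma gradNorm_comp {h : ℝ → ℝ} {h' : ℝ} (hh : HasDerivAt h h' (f x))
    (hf : DifferentiableAt ℝ f x) :
    G.gradNorm (fun y => h (f y)) x = |h'| * G.gradNorm f x := by
  simp only [gradNorm, X_comp _ hh hf, mul_pow, ← Finset.mul_sum]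
  rw [Real.sqrt_mul (sq_nonneg _), Real.sqrt_sq_eq_abs]

lemma contDiffOn_gradNorm_sq (hU : IsOpen U) (hf : ContDiffOn ℝ ∞ f U) :
    ContDiffOn ℝ ∞ (fun x => G.gradNorm f x ^ 2) U := by
  simp only [gradNorm_sq]
  exact ContDiffOn.sum fun j _ => (contDiffOn_X j hU hf).pow 2

lemma continuousOn_gradNorm (hU : IsOpen U) (hf : ContDiffOn ℝ ∞ f U) :
    ContinuousOn (G.gradNorm f) U :=
  (continuousOn_finsetSum _ fun j _ => (contDiffOn_X j hU hf).continuousOn.pow 2).sqrt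

lemma continuous_gradNorm (hf : ContDiff ℝ 1 f) : Continuous (G.gradNorm f) :=
  (continuous_finsetSum _ fun j _ => (continuous_X j hf).pow 2).sqrt

lemma gradNorm_eq_zero_of_notMem_tsupport (hx : x ∉ tsupport f) : G.gradNorm f x = 0 :=
  gradNorm_eq_zero_iff.2 fun j _ => X_eq_zero_of_notMem_tsupport j hx

lemma tsupport_gradNorm_subset (f : (Fin n → ℝ) → ℝ) :
    tsupport (G.gradNorm f) ⊆ tsupport f :=
  closure_minimal (fun _ hx => of_not_not fun h => hx (gradNorm_eq_zero_of_notMem_tsupport h))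
    (isClosed_tsupport f)

lemma hasCompactSupport_gradNorm (hf : HasCompactSupport f) :
    HasCompactSupport (G.gradNorm f) :=
  hf.of_isClosed_subset (isClosed_tsupport _) (tsupport_gradNorm_subset f)

lemma gradInner_self (f : (Fin n → ℝ) → ℝ) (x : Fin n → ℝ) :
    G.gradInner f f x = G.gradNorm f x ^ 2 := by
  rw [gradNorm_sq]
  exact Finset.sum_congr rfl fun j _ => (sq _).symm

lemma abs_gradInner_le (f g : (Fin n → ℝ) → ℝ) (x : Fin n → ℝ) :
    |G.gradInner f g x| ≤ G.gradNorm f x * G.gradNorm g x := by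
  refine abs_le_of_sq_le_sq ?_ (mul_nonneg (gradNorm_nonneg _ _) (gradNorm_nonneg _ _))
  rw [mul_pow, gradNorm_sq, gradNorm_sq]
  exact Finset.sum_mul_sq_le_sq_mul_sq _ _ _

lemma gradInner_mul_left (hf : DifferentiableAt ℝ f x) (hg : DifferentiableAt ℝ g x) :
    G.gradInner (fun y => f y * g y) k x =
      f x * G.gradInner g k x + G.gradInner f k x * g x := by
  simp only [gradInner, X_mul _ hf hg, Finset.mul_sum, Finset.sum_mul, ← Finset.sum_add_distrib]
  exact Finset.sum_congr rfl fun _ _ => by ring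

lemma gradInner_comp_left {h : ℝ → ℝ} {h' : ℝ} (hh : HasDerivAt h h' (f x))
    (hf : DifferentiableAt ℝ f x) :
    G.gradInner (fun y => h (f y)) g x = h' * G.gradInner f g x := by
  simp only [gradInner, X_comp _ hh hf, Finset.mul_sum, _root_.mul_assoc]

lemma sum_X_mul_X (hf : DifferentiableAt ℝ f x) (hg : ∀ j, DifferentiableAt ℝ (G.X j g) x) :
    ∑ j ∈ G.horizontal, G.X j (fun y => f y * G.X j g y) x =
      f x * G.subLaplacian g x + G.gradInner f g x := by
  simp only [X_mul _ hf (hg _), Finset.sum_add_distrib, subLaplacian, gradInner, Finset.mul_sum]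

lemma subLaplacian_congr (h : f =ᶠ[𝓝 x] g) : G.subLaplacian f x = G.subLaplacian g x :=
  Finset.sum_congr rfl fun j _ => X_congr j <| h.eventuallyEq_nhds.mono fun _ => X_congr j

lemma subLaplacian_comp (hU : IsOpen U) (hf : ContDiffOn ℝ ∞ f U) (hx : x ∈ U) {h h' : ℝ → ℝ}
    {h'' : ℝ} (hh : ∀ y ∈ U, HasDerivAt h (h' (f y)) (f y)) (hh' : HasDerivAt h' h'' (f x)) :
    G.subLaplacian (fun y => h (f y)) x =
      h' (f x) * G.subLaplacian f x + h'' * G.gradNorm f x ^ 2 := by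
  have hdf {y} (hy : y ∈ U) : DifferentiableAt ℝ f y :=
    (hf.contDiffAt (hU.mem_nhds hy)).differentiableAt (by simp)
  have hX (j : Fin n) : G.X j (fun y => h (f y)) =ᶠ[𝓝 x] fun y => h' (f y) * G.X j f y :=
    (hU.eventually_mem hx).mono fun y hy => X_comp j (hh y hy) (hdf hy)
  rw [subLaplacian, Finset.sum_congr rfl fun j _ => X_congr j (hX j),
    sum_X_mul_X (f := fun y => h' (f y)) (hh'.differentiableAt.comp x (hdf hx))
      fun j => differentiableAt_X j hU hf hx,
    gradInner_comp_left hh' (hdf hx), gradInner_self]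

lemma contDiffOn_subLaplacian (hU : IsOpen U) (hf : ContDiffOn ℝ ∞ f U) :
    ContDiffOn ℝ ∞ (G.subLaplacian f) U :=
  ContDiffOn.sum fun j _ => contDiffOn_X j hU (contDiffOn_X j hU hf)

lemma integral_X_eq_zero (j : Fin n) (hf : ContDiff ℝ 1 f) (hc : HasCompactSupport f) :
    ∫ x, G.X j f x = 0 := by
  set a : Fin n → (Fin n → ℝ) → ℝ := fun k y => leftInvariantField G.mul (Pi.single j 1) y k
  have ha (k : Fin n) : ContDiff ℝ ∞ (a k) := contDiff_pi.1 (G.contDiff_leftInvariantField _) k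
  have hdiv (k : Fin n) (x : Fin n → ℝ) : fderiv ℝ (a k) x (Pi.single k 1) = 0 :=
    G.fderiv_leftInvariantField_diag j k x
  have hint (k : Fin n) : Integrable fun x => a k x * fderiv ℝ f x (Pi.single k 1) :=
    ((ha k).continuous.mul ((hf.continuous_fderiv (by simp)).clm_apply
      continuous_const)).integrable_of_hasCompactSupport (hc.fderiv_apply ℝ _).mul_left
  simp only [X_eq_sum]
  rw [integral_finsetSum _ fun k _ => hint k]
  refine Finset.sum_eq_zero fun k _ => ?_
  rw [integral_mul_fderiv_eq_neg_fderiv_mul_of_integrable (by simp [hdiv]) (hint k)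
    (((ha k).continuous.mul hf.continuous).integrable_of_hasCompactSupport hc.mul_left)
    (fun x _ => (ha k).differentiable (by simp) x) fun x _ => hf.differentiable (by simp) x]
  simp [hdiv]

lemma integral_X_mul_eq_neg (j : Fin n) (hU : IsOpen U) (hf : ContDiffOn ℝ ∞ f U)
    (hψ : ContDiff ℝ 1 ψ) (hc : HasCompactSupport ψ) (hs : tsupport ψ ⊆ U) :
    ∫ x, G.X j f x * ψ x = -∫ x, f x * G.X j ψ x := by
  have hprod (x : Fin n → ℝ) :
      G.X j (fun y => f y * ψ y) x = f x * G.X j ψ x + G.X j f x * ψ x := by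
    by_cases hx : x ∈ tsupport ψ
    · exact X_mul j ((hf.contDiffAt (hU.mem_nhds (hs hx))).differentiableAt (by simp))
        (hψ.differentiable (by simp) x)
    · rw [X_eq_zero_of_notMem_tsupport j hx, image_eq_zero_of_notMem_tsupport hx,
        X_eq_zero_of_notMem_tsupport j fun h => hx (tsupport_mul_subset_right h)]
      simp
  have hleft : Integrable fun x => f x * G.X j ψ x :=
    integrable_mul_of_tsupport_subset hU hf.continuousOn (continuous_X j hψ)
      (hasCompactSupport_X j hc) ((tsupport_X_subset j ψ).trans hs)
  have hright : Integrable fun x => G.X j f x * ψ x :=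
    integrable_mul_of_tsupport_subset hU (contDiffOn_X j hU hf).continuousOn hψ.continuous hc hs
  have hzero := integral_X_eq_zero (G := G) j
    (contDiff_mul_of_tsupport_subset hU (hf.of_le (by simp)) hψ hs) hc.mul_left
  simp only [hprod] at hzero
  rw [integral_add hleft hright] at hzero
  linarith

lemma integral_subLaplacian_mul (hU : IsOpen U) (hf : ContDiffOn ℝ ∞ f U)
    (hψ : ContDiff ℝ ∞ ψ) (hc : HasCompactSupport ψ) (hs : tsupport ψ ⊆ U) :
    ∫ x, G.subLaplacian f x * ψ x = ∫ x, f x * G.subLaplacian ψ x := by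
  have hXψ (j : Fin n) : ContDiff ℝ ∞ (G.X j ψ) := contDiff_X j hψ
  have hXc (j : Fin n) : HasCompactSupport (G.X j ψ) := hasCompactSupport_X j hc
  have hXs (j : Fin n) : tsupport (G.X j ψ) ⊆ U := (tsupport_X_subset j ψ).trans hs
  simp only [subLaplacian, Finset.sum_mul, Finset.mul_sum]
  rw [integral_finsetSum _ fun j _ => integrable_mul_of_tsupport_subset hU
      (contDiffOn_X j hU (contDiffOn_X j hU hf)).continuousOn hψ.continuous hc hs,
    integral_finsetSum _ fun j _ => integrable_mul_of_tsupport_subset hU hf.continuousOn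
      (contDiff_X j (hXψ j)).continuous (hasCompactSupport_X j (hXc j))
      ((tsupport_X_subset j _).trans (hXs j))]
  refine Finset.sum_congr rfl fun j _ => ?_
  rw [integral_X_mul_eq_neg j hU (contDiffOn_X j hU hf) (hψ.of_le (by simp)) hc hs,
    integral_X_mul_eq_neg j hU hf ((hXψ j).of_le (by simp)) (hXc j) (hXs j), neg_neg]

lemma integral_mul_subLaplacian_add_gradInner (hU : IsOpen U) (hf : ContDiffOn ℝ ∞ f U)
    (hg : ContDiffOn ℝ ∞ g U) (hψ : ContDiff ℝ 1 ψ) (hc : HasCompactSupport ψ)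
    (hs : tsupport ψ ⊆ U) :
    ∫ x, (f x * G.subLaplacian g x + G.gradInner f g x) * ψ x =
      -∫ x, f x * G.gradInner g ψ x := by
  have hfX (j : Fin n) : ContDiffOn ℝ ∞ (fun x => f x * G.X j g x) U :=
    hf.mul (contDiffOn_X j hU hg)
  have hdiv (x : Fin n → ℝ) : (f x * G.subLaplacian g x + G.gradInner f g x) * ψ x =
      ∑ j ∈ G.horizontal, G.X j (fun y => f y * G.X j g y) x * ψ x := by
    by_cases hx : x ∈ tsupport ψ
    · rw [← Finset.sum_mul, sum_X_mul_X
        ((hf.contDiffAt (hU.mem_nhds (hs hx))).differentiableAt (by simp))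
        fun j => differentiableAt_X j hU hg (hs hx)]
    · simp [image_eq_zero_of_notMem_tsupport hx]
  simp only [hdiv]
  simp only [gradInner, Finset.mul_sum, ← _root_.mul_assoc]
  rw [integral_finsetSum _ fun j _ => integrable_mul_of_tsupport_subset hU
      (contDiffOn_X j hU (hfX j)).continuousOn hψ.continuous hc hs,
    integral_finsetSum _ fun j _ => integrable_mul_of_tsupport_subset hU (hfX j).continuousOn
      (continuous_X j hψ) (hasCompactSupport_X j hc) ((tsupport_X_subset j ψ).trans hs),
    ← Finset.sum_neg_distrib]
  exact Finset.sum_congr rfl fun j _ => integral_X_mul_eq_neg j hU (hfX j) hψ hc hs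

end CarnotGroup

/-! ### The gauge -/

namespace CarnotGroup

variable {n : ℕ} {G : CarnotGroup n} {u f N : (Fin n → ℝ) → ℝ} {x : Fin n → ℝ}

lemma IsFundamentalSolution.subLaplacian_eq_zero (hu : G.IsFundamentalSolution u)
    (hsmooth : ContDiffOn ℝ ∞ u {0}ᶜ) (hx : x ≠ 0) : G.subLaplacian u x = 0 := by
  have hopen : IsOpen ({0}ᶜ : Set (Fin n → ℝ)) := isOpen_compl_singleton
  have hcont : ContinuousOn (G.subLaplacian u) {0}ᶜ :=
    (contDiffOn_subLaplacian hopen hsmooth).continuousOn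
  have hae : ∀ᵐ y, y ∈ ({0}ᶜ : Set (Fin n → ℝ)) → G.subLaplacian u y = 0 := by
    refine hopen.ae_eq_zero_of_integral_contDiff_smul_eq_zero
      (hcont.locallyIntegrableOn hopen.measurableSet) fun φ hφ hc hs => ?_
    have hφ0 : φ 0 = 0 := image_eq_zero_of_notMem_tsupport fun h => hs h rfl
    simp only [smul_eq_mul, mul_comm (φ _)]
    rw [integral_subLaplacian_mul hopen hsmooth hφ hc hs, ← neg_eq_zero, hu.weak_eq φ hφ hc, hφ0]
  exact Measure.eqOn_open_of_ae_eq (μ := volume) (g := 0)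
    ((ae_restrict_iff' hopen.measurableSet).2 hae) hopen hcont continuousOn_const hx

lemma IsFundamentalSolution.eq_zero_of_X_eq_zero (hu : G.IsFundamentalSolution u)
    (hf : ContDiff ℝ ∞ f) (hc : HasCompactSupport f)
    (hX : ∀ j ∈ G.horizontal, ∀ x, G.X j f x = 0) : f 0 = 0 := by
  have hΔ (x : Fin n → ℝ) : G.subLaplacian f x = 0 := Finset.sum_eq_zero fun j hj => by
    rw [funext (hX j hj)]
    simp [X]
  simp [← hu.weak_eq f hf hc, hΔ]

lemma mul_subLaplacian_of_subLaplacian_rpow_eq_zero {U : Set (Fin n → ℝ)} (hU : IsOpen U)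
    (hN : ContDiffOn ℝ ∞ N U) (hpos : ∀ y ∈ U, 0 < N y) (hx : x ∈ U) {Q : ℝ} (hQ : Q ≠ 2)
    (h : G.subLaplacian (fun y => N y ^ (2 - Q)) x = 0) :
    N x * G.subLaplacian N x = (Q - 1) * G.gradNorm N x ^ 2 := by
  have hNx : 0 < N x := hpos x hx
  have hderiv (q : ℝ) {y : Fin n → ℝ} (hy : y ∈ U) :
      HasDerivAt (fun t : ℝ => t ^ q) (q * N y ^ (q - 1)) (N y) :=
    Real.hasDerivAt_rpow_const (Or.inl (hpos y hy).ne')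
  rw [subLaplacian_comp hU hN hx (h' := fun t => (2 - Q) * t ^ (2 - Q - 1))
    (fun y hy => hderiv _ hy) ((hderiv _ hx).const_mul (2 - Q))] at h
  have hsplit : N x ^ (2 - Q - 1) = N x ^ (2 - Q - 1 - 1) * N x := by
    rw [← Real.rpow_add_one hNx.ne', sub_add_cancel]
  have hfactor : ((2 - Q) * N x ^ (2 - Q - 1 - 1)) *
      (N x * G.subLaplacian N x - (Q - 1) * G.gradNorm N x ^ 2) = 0 := by
    rw [← h, hsplit]
    ring
  have hne : (2 - Q) * N x ^ (2 - Q - 1 - 1) ≠ 0 :=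
    mul_ne_zero (sub_ne_zero.2 hQ.symm) (Real.rpow_pos_of_pos hNx _).ne'
  exact sub_eq_zero.1 ((mul_eq_zero.1 hfactor).resolve_left hne)

lemma exists_norm_dilation_eq_one (G : CarnotGroup n) (hx : 1 ≤ ‖x‖) :
    ∃ s ∈ Ioc (0 : ℝ) 1, ‖G.dilation s x‖ = 1 := by
  have hzero : ‖G.dilation 0 x‖ = 0 := by rw [dilation_zero_left, norm_zero]
  obtain ⟨s, hs, hs1⟩ := intermediate_value_Icc zero_le_one
    (G.continuous_dilation_left x).norm.continuousOn
    (show (1 : ℝ) ∈ Icc ‖G.dilation 0 x‖ ‖G.dilation 1 x‖ by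
      rw [hzero, dilation_one]
      exact ⟨zero_le_one, hx⟩)
  refine ⟨s, ⟨hs.1.lt_of_ne ?_, hs.2⟩, hs1⟩
  rintro rfl
  exact zero_ne_one (hzero.symm.trans hs1)

namespace IsHomogeneousNorm

lemma pos (hN : G.IsHomogeneousNorm N) (hx : x ≠ 0) : 0 < N x :=
  (hN.nonneg x).lt_of_ne fun h => hx ((hN.eq_zero_iff x).1 h.symm)

lemma differentiableAt (hN : G.IsHomogeneousNorm N) (hx : x ≠ 0) : DifferentiableAt ℝ N x :=
  (hN.smooth.contDiffAt (isOpen_compl_singleton.mem_nhds hx)).differentiableAt (by simp)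

lemma exists_norm_lt_one (hN : G.IsHomogeneousNorm N) : ∃ m > 0, ∀ x, N x < m → ‖x‖ < 1 := by
  obtain ⟨m, hm, hsphere⟩ := (isCompact_sphere (0 : Fin n → ℝ) 1).exists_forall_le'
    hN.continuous.continuousOn fun x hx => hN.pos (ne_zero_of_mem_unit_sphere ⟨x, hx⟩)
  refine ⟨m, hm, fun x hx => ?_⟩
  contrapose! hx
  obtain ⟨s, hs, hs1⟩ := G.exists_norm_dilation_eq_one hx
  calc m ≤ N (G.dilation s x) := hsphere _ (by simpa using hs1)
    _ = s * N x := hN.dilation s hs.1 x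
    _ ≤ N x := mul_le_of_le_one_left (hN.nonneg x) hs.2

lemma isCompact_le (hN : G.IsHomogeneousNorm N) (R : ℝ) : IsCompact {x | N x ≤ R} := by
  obtain ⟨m, hm, hball⟩ := hN.exists_norm_lt_one
  obtain ⟨r, hr, hrR⟩ := exists_pos_mul_lt hm R
  refine ((isCompact_closedBall 0 1).image (G.continuous_dilation r⁻¹)).of_isClosed_subset
    (isClosed_le hN.continuous continuous_const) fun x (hx : N x ≤ R) => ?_
  refine ⟨G.dilation r x, ?_, by rw [dilation_dilation, inv_mul_cancel₀ hr.ne', dilation_one]⟩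
  refine mem_closedBall_zero_iff.2 (hball _ ?_).le
  rw [hN.dilation r hr, mul_comm]
  exact (mul_le_mul_of_nonneg_right hx hr.le).trans_lt hrR

lemma isCompact_preimage (hN : G.IsHomogeneousNorm N) {K : Set ℝ} (hK : IsCompact K) :
    IsCompact (N ⁻¹' K) := by
  obtain ⟨R, hR⟩ := hK.bddAbove
  exact (hN.isCompact_le R).of_isClosed_subset (hK.isClosed.preimage hN.continuous) fun _ hx =>
    hR hx

lemma X_dilation (hN : G.IsHomogeneousNorm N) {j : Fin n} (hj : j ∈ G.horizontal) {r : ℝ}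
    (hr : 0 < r) (hx : x ≠ 0) : G.X j N (G.dilation r x) = G.X j N x := by
  have hscale : G.X j (fun y => N (G.dilation r y)) x = r * G.X j N x := by
    simp only [hN.dilation r hr]
    simpa using X_comp j ((hasDerivAt_id (N x)).const_mul r) (hN.differentiableAt hx)
  rw [X_comp_dilation j hr (hN.differentiableAt (G.dilation_ne_zero hr hx)),
    (Finset.mem_filter.1 hj).2, pow_one] at hscale
  exact mul_left_cancel₀ hr.ne' hscale

lemma gradNorm_dilation (hN : G.IsHomogeneousNorm N) {r : ℝ} (hr : 0 < r)
    (hx : x ≠ 0) : G.gradNorm N (G.dilation r x) = G.gradNorm N x := by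
  simp only [gradNorm]
  rw [Finset.sum_congr rfl fun j hj => by rw [hN.X_dilation hj hr hx]]

end IsHomogeneousNorm

lemma gauge_eq_of_eq_rpow (hN : G.IsHomogeneousNorm N) (hQ : G.homDim ≠ 2)
    (hu : ∀ x ≠ 0, u x = N x ^ (2 - (G.homDim : ℝ))) : G.gauge u = N := by
  have hQ' : 2 - (G.homDim : ℝ) ≠ 0 := sub_ne_zero.2 (by exact_mod_cast hQ.symm)
  funext x
  by_cases hx : x = 0
  · simp [gauge, hx, (hN.eq_zero_iff 0).2 rfl]
  · rw [gauge, if_neg hx, hu x hx, ← Real.rpow_mul (hN.nonneg x), mul_one_div_cancel hQ',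
      Real.rpow_one]

namespace IsFollandSolution

lemma isHomogeneousNorm_gauge (hu : G.IsFollandSolution u) (hQ : G.homDim ≠ 2) :
    G.IsHomogeneousNorm (G.gauge u) := by
  obtain ⟨N, hN, h⟩ := hu.eq_norm_rpow
  rwa [gauge_eq_of_eq_rpow hN hQ h]

lemma eq_gauge_rpow (hu : G.IsFollandSolution u) (hQ : G.homDim ≠ 2) (hx : x ≠ 0) :
    u x = G.gauge u x ^ (2 - (G.homDim : ℝ)) := by
  obtain ⟨N, hN, h⟩ := hu.eq_norm_rpow
  rw [gauge_eq_of_eq_rpow hN hQ h, h x hx]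

lemma gauge_mul_subLaplacian (hu : G.IsFollandSolution u) (hQ : G.homDim ≠ 2) (hx : x ≠ 0) :
    G.gauge u x * G.subLaplacian (G.gauge u) x =
      ((G.homDim : ℝ) - 1) * G.gradNorm (G.gauge u) x ^ 2 := by
  have hN : G.IsHomogeneousNorm (G.gauge u) := hu.isHomogeneousNorm_gauge hQ
  have hopen : IsOpen ({0}ᶜ : Set (Fin n → ℝ)) := isOpen_compl_singleton
  have hsmooth : ContDiffOn ℝ ∞ u {0}ᶜ :=
    (hN.smooth.rpow_const_of_ne fun y hy => (hN.pos hy).ne').congr fun y => hu.eq_gauge_rpow hQ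
  refine mul_subLaplacian_of_subLaplacian_rpow_eq_zero hopen hN.smooth (fun y hy => hN.pos hy) hx
    (by exact_mod_cast hQ) ?_
  rw [← hu.fundamental.subLaplacian_eq_zero hsmooth hx]
  exact subLaplacian_congr <|
    (hopen.eventually_mem hx).mono fun y hy => (hu.eq_gauge_rpow hQ hy).symm

end IsFollandSolution

end CarnotGroup

/-! ### The Hardy inequality -/

/-- A smooth truncation of `s ↦ s ^ β` near its singularity at `0`: it vanishes for `s ≤ ε` and
is `s ^ β` for `s ≥ 2 ε`. -/
noncomputable def truncRpow (ε β s : ℝ) : ℝ := Real.smoothTransition (s / ε - 1) * s ^ β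

section TruncRpow

variable {ε β s : ℝ}

lemma truncRpow_nonneg (hs : 0 ≤ s) : 0 ≤ truncRpow ε β s :=
  mul_nonneg (Real.smoothTransition.nonneg _) (Real.rpow_nonneg hs β)

lemma truncRpow_le_rpow (hs : 0 ≤ s) : truncRpow ε β s ≤ s ^ β :=
  mul_le_of_le_one_left (Real.rpow_nonneg hs β) (Real.smoothTransition.le_one _)

lemma contDiff_truncRpow (hε : 0 < ε) : ContDiff ℝ ∞ (truncRpow ε β) := by
  refine contDiff_iff_contDiffAt.2 fun s => ?_
  rcases lt_or_ge 0 s with hs | hs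
  · exact (Real.smoothTransition.contDiff.comp (by fun_prop)).contDiffAt.mul
      (Real.contDiffAt_rpow_const_of_ne hs.ne')
  · refine (contDiffAt_const (c := (0 : ℝ))).congr_of_eventuallyEq ?_
    filter_upwards [Iio_mem_nhds (hs.trans_lt hε)] with t ht
    rw [truncRpow, Real.smoothTransition.zero_of_nonpos, MulZeroClass.zero_mul]
    exact sub_nonpos.2 ((div_le_one hε).2 ht.le)

lemma eventually_truncRpow_eq (hs : 0 < s) : ∀ᶠ ε in 𝓝[>] 0, truncRpow ε β s = s ^ β := by
  filter_upwards [Ioo_mem_nhdsGT (half_pos hs)] with ε hε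
  rw [truncRpow, Real.smoothTransition.one_of_one_le, one_mul]
  rw [le_sub_iff_add_le, le_div_iff₀ hε.1]
  linarith [hε.2]

end TruncRpow

lemma sq_rpow_sub_two_div_two {t : ℝ} (ht : 0 ≤ t) (p : ℝ) :
    (t ^ 2) ^ ((p - 2) / 2) = t ^ (p - 2) := by
  rw [← Real.rpow_natCast_mul ht]
  congr 1
  push_cast
  ring

section

variable {p t : ℝ}

lemma truncRpow_sq_mul_le (ht : 0 ≤ t) (hp : 1 < p) (ε : ℝ) :
    truncRpow ε ((p - 2) / 2) (t ^ 2) * t ≤ t ^ (p - 1) := by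
  calc truncRpow ε ((p - 2) / 2) (t ^ 2) * t ≤ t ^ (p - 2) * t := by
        rw [← sq_rpow_sub_two_div_two ht]
        exact mul_le_mul_of_nonneg_right (truncRpow_le_rpow (sq_nonneg t)) ht
    _ = t ^ (p - 1) := by
        rw [← Real.rpow_add_one' ht (by linarith)]
        ring_nf

lemma truncRpow_sq_mul_sq_le (ht : 0 ≤ t) (hp : 0 < p) (ε : ℝ) :
    truncRpow ε ((p - 2) / 2) (t ^ 2) * t ^ 2 ≤ t ^ p := by
  calc truncRpow ε ((p - 2) / 2) (t ^ 2) * t ^ 2 ≤ t ^ (p - 2) * t ^ 2 := by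
        rw [← sq_rpow_sub_two_div_two ht]
        exact mul_le_mul_of_nonneg_right (truncRpow_le_rpow (sq_nonneg t)) (sq_nonneg t)
    _ = t ^ p := by
        rw [← Real.rpow_add_natCast' ht (by push_cast; linarith)]
        push_cast
        ring_nf

lemma tendsto_truncRpow_sq_mul_sq (ht : 0 ≤ t) (hp : 0 < p) :
    Tendsto (fun ε => truncRpow ε ((p - 2) / 2) (t ^ 2) * t ^ 2) (𝓝[>] 0) (𝓝 (t ^ p)) := by
  rcases ht.eq_or_lt with rfl | ht
  · simp [Real.zero_rpow hp.ne']
  · refine tendsto_const_nhds.congr' ?_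
    filter_upwards [eventually_truncRpow_eq (pow_pos ht 2)] with ε hε
    rw [hε, sq_rpow_sub_two_div_two ht.le, ← Real.rpow_natCast, ← Real.rpow_add ht]
    push_cast
    ring_nf

end

lemma mul_rpow_sub_one_mul_le {p a b : ℝ} (hp : 1 < p) (ha : 0 ≤ a) (hb : 0 ≤ b) :
    p * (a ^ (p - 1) * b) ≤ b ^ p + (p - 1) * a ^ p := by
  have hp0 : 0 < p := one_pos.trans hp
  have hp1 : p - 1 ≠ 0 := (sub_pos.2 hp).ne'
  have hyoung := Real.young_inequality_of_nonneg (Real.rpow_nonneg ha (p - 1)) hb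
    (Real.HolderConjugate.conjExponent hp).symm
  rw [← Real.rpow_mul ha, Real.conjExponent, mul_div_cancel₀ _ hp1] at hyoung
  calc p * (a ^ (p - 1) * b) ≤ p * (a ^ p / (p / (p - 1)) + b ^ p / p) := by gcongr
    _ = b ^ p + (p - 1) * a ^ p := by field_simp; ring

namespace CarnotGroup

variable {n : ℕ} {G : CarnotGroup n} {N φ ψ : (Fin n → ℝ) → ℝ} {U : Set (Fin n → ℝ)}
  {x : Fin n → ℝ} {p Q : ℝ}

lemma gradNorm_abs_rpow (hp : 1 < p) (hφ : DifferentiableAt ℝ φ x) :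
    G.gradNorm (fun y => |φ y| ^ p) x = p * (|φ x| ^ (p - 1) * G.gradNorm φ x) := by
  rw [gradNorm_comp (hasDerivAt_abs_rpow (φ x) hp) hφ, abs_mul, abs_mul,
    abs_of_pos (one_pos.trans hp), abs_of_nonneg (Real.rpow_nonneg (abs_nonneg _) _),
    ← _root_.mul_assoc, _root_.mul_assoc p, ← Real.rpow_add_one' (abs_nonneg _) (by linarith)]
  ring_nf

/-- The properties of the gauge of a polarizable group of homogeneous dimension `Q` that enter the
Hardy inequality on the open set `U`: `N^{2-Q}` is harmonic, written as `N Δ N = (Q - 1) |∇N|²`,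
and `N` is `∞`-harmonic. -/
structure IsPolarGauge (G : CarnotGroup n) (N : (Fin n → ℝ) → ℝ) (Q : ℝ)
    (U : Set (Fin n → ℝ)) : Prop where
  isOpen : IsOpen U
  smooth : ContDiffOn ℝ ∞ N U
  pos : ∀ x ∈ U, 0 < N x
  mul_subLaplacian : ∀ x ∈ U, N x * G.subLaplacian N x = (Q - 1) * G.gradNorm N x ^ 2
  infSubLaplacian_eq_zero : ∀ x ∈ U, G.infSubLaplacian N x = 0

/-- The pairing `|∇N|^{p-1} N^{1-p} |φ|^{p-1} |∇φ|` that Young's inequality splits into the two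
sides of the Hardy inequality. -/
noncomputable def hardyPairing (G : CarnotGroup n) (N : (Fin n → ℝ) → ℝ) (p : ℝ)
    (φ : (Fin n → ℝ) → ℝ) (x : Fin n → ℝ) : ℝ :=
  (G.gradNorm N x / N x * |φ x|) ^ (p - 1) * G.gradNorm φ x

lemma integrable_gradNorm_rpow (hp : 0 < p) (hφ : ContDiff ℝ 1 φ) (hc : HasCompactSupport φ) :
    Integrable fun x => G.gradNorm φ x ^ p :=
  ((continuous_gradNorm hφ).rpow_const fun _ => Or.inr hp.le).integrable_of_hasCompactSupport <|
    (hasCompactSupport_gradNorm hc).comp_left (g := fun t : ℝ => t ^ p) (Real.zero_rpow hp.ne')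

lemma tsupport_abs_rpow_subset (hp : p ≠ 0) (φ : (Fin n → ℝ) → ℝ) :
    tsupport (fun x => |φ x| ^ p) ⊆ tsupport φ :=
  closure_mono fun x hx h => hx (by simp [h, Real.zero_rpow hp])

namespace IsPolarGauge

lemma gradInner_gradNorm_sq (hN : G.IsPolarGauge N Q U) (hx : x ∈ U) :
    G.gradInner (fun y => G.gradNorm N y ^ 2) N x = 0 := by
  simpa [infSubLaplacian] using hN.infSubLaplacian_eq_zero x hx

lemma continuousOn_gradNorm_div (hN : G.IsPolarGauge N Q U) :
    ContinuousOn (fun x => G.gradNorm N x / N x) U :=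
  (continuousOn_gradNorm hN.isOpen hN.smooth).div hN.smooth.continuousOn fun x hx =>
    (hN.pos x hx).ne'

lemma contDiffOn_rpow (hN : G.IsPolarGauge N Q U) (q : ℝ) :
    ContDiffOn ℝ ∞ (fun x => N x ^ q) U :=
  hN.smooth.rpow_const_of_ne fun x hx => (hN.pos x hx).ne'

lemma contDiffOn_comp_gradNorm_sq (hN : G.IsPolarGauge N Q U) {h : ℝ → ℝ} (hh : ContDiff ℝ ∞ h) :
    ContDiffOn ℝ ∞ (fun x => h (G.gradNorm N x ^ 2)) U :=
  hh.comp_contDiffOn (contDiffOn_gradNorm_sq hN.isOpen hN.smooth)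

-- `h (|∇N|²)` is constant along `∇N`, so only the radial factor `N^{1-p}` is differentiated.
lemma mul_subLaplacian_add_gradInner (hN : G.IsPolarGauge N Q U) {h : ℝ → ℝ}
    (hh : Differentiable ℝ h) (hx : x ∈ U) :
    h (G.gradNorm N x ^ 2) * N x ^ (1 - p) * G.subLaplacian N x +
        G.gradInner (fun y => h (G.gradNorm N y ^ 2) * N y ^ (1 - p)) N x =
      (Q - p) * (h (G.gradNorm N x ^ 2) * G.gradNorm N x ^ 2 / N x ^ p) := by
  have hNx : 0 < N x := hN.pos x hx
  have hdN : DifferentiableAt ℝ N x :=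
    (hN.smooth.contDiffAt (hN.isOpen.mem_nhds hx)).differentiableAt (by simp)
  have hdsq : DifferentiableAt ℝ (fun y => G.gradNorm N y ^ 2) x :=
    ((contDiffOn_gradNorm_sq hN.isOpen hN.smooth).contDiffAt
      (hN.isOpen.mem_nhds hx)).differentiableAt (by simp)
  have hrpow : HasDerivAt (fun t : ℝ => t ^ (1 - p)) ((1 - p) * N x ^ (1 - p - 1)) (N x) :=
    Real.hasDerivAt_rpow_const (Or.inl hNx.ne')
  rw [gradInner_mul_left (f := fun y => h (G.gradNorm N y ^ 2)) (g := fun y => N y ^ (1 - p))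
      ((hh _).comp x hdsq) (hrpow.differentiableAt.comp x hdN),
    gradInner_comp_left (f := fun y => G.gradNorm N y ^ 2) (hh _).hasDerivAt hdsq,
    hN.gradInner_gradNorm_sq hx, gradInner_comp_left hrpow hdN, gradInner_self,
    Real.rpow_sub hNx 1, Real.rpow_one, show 1 - p - 1 = -p by ring, Real.rpow_neg hNx.le]
  linear_combination h (G.gradNorm N x ^ 2) / N x ^ p * hN.mul_subLaplacian x hx

lemma integral_comp_gradNorm_sq_mul (hN : G.IsPolarGauge N Q U) {h : ℝ → ℝ}
    (hh : ContDiff ℝ ∞ h) (hψ : ContDiff ℝ 1 ψ) (hc : HasCompactSupport ψ) (hs : tsupport ψ ⊆ U) :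
    (Q - p) * ∫ x, h (G.gradNorm N x ^ 2) * G.gradNorm N x ^ 2 / N x ^ p * ψ x =
      -∫ x, h (G.gradNorm N x ^ 2) * N x ^ (1 - p) * G.gradInner N ψ x := by
  rw [← integral_mul_subLaplacian_add_gradInner hN.isOpen
    ((hN.contDiffOn_comp_gradNorm_sq hh).mul (hN.contDiffOn_rpow (1 - p))) hN.smooth hψ hc hs,
    ← integral_const_mul]
  congr 1 with x
  by_cases hx : x ∈ tsupport ψ
  · rw [hN.mul_subLaplacian_add_gradInner (hh.differentiable (by simp)) (hs hx)]
    ring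
  · simp [image_eq_zero_of_notMem_tsupport hx]

lemma integrable_hardyWeight (hN : G.IsPolarGauge N Q U) (hp : 0 < p) (hφ : Continuous φ)
    (hc : HasCompactSupport φ) (hs : tsupport φ ⊆ U) :
    Integrable fun x => G.gradNorm N x ^ p / N x ^ p * |φ x| ^ p := by
  have hsub : tsupport (fun x => |φ x| ^ p) ⊆ tsupport φ := tsupport_abs_rpow_subset hp.ne' φ
  refine integrable_mul_of_tsupport_subset hN.isOpen ?_
    (hφ.abs.rpow_const fun _ => Or.inr hp.le)
    (hc.of_isClosed_subset (isClosed_tsupport _) hsub) (hsub.trans hs)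
  exact ((continuousOn_gradNorm hN.isOpen hN.smooth).rpow_const fun _ _ => Or.inr hp.le).div
    (hN.contDiffOn_rpow p).continuousOn fun x hx => (Real.rpow_pos_of_pos (hN.pos x hx) p).ne'

lemma integrable_hardyPairing (hN : G.IsPolarGauge N Q U) (hp : 1 < p) (hφ : ContDiff ℝ 1 φ)
    (hc : HasCompactSupport φ) (hs : tsupport φ ⊆ U) : Integrable (G.hardyPairing N p φ) := by
  refine integrable_mul_of_tsupport_subset hN.isOpen ?_ (continuous_gradNorm hφ)
    (hasCompactSupport_gradNorm hc) ((tsupport_gradNorm_subset φ).trans hs)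
  exact (hN.continuousOn_gradNorm_div.mul hφ.continuous.abs.continuousOn).rpow_const
    fun _ _ => Or.inr (sub_pos.2 hp).le

lemma integrable_comp_gradNorm_sq_mul (hN : G.IsPolarGauge N Q U) {h : ℝ → ℝ}
    (hh : ContDiff ℝ ∞ h) (q : ℝ) (hψ : Continuous ψ) (hc : HasCompactSupport ψ)
    (hs : tsupport ψ ⊆ U) :
    Integrable fun x => h (G.gradNorm N x ^ 2) * G.gradNorm N x ^ 2 / N x ^ q * ψ x :=
  integrable_mul_of_tsupport_subset hN.isOpen
    (((hN.contDiffOn_comp_gradNorm_sq hh).mul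
      (contDiffOn_gradNorm_sq hN.isOpen hN.smooth)).continuousOn.div
      (hN.contDiffOn_rpow q).continuousOn
      fun x hx => (Real.rpow_pos_of_pos (hN.pos x hx) q).ne') hψ hc hs

lemma abs_truncRpow_mul_gradInner_le (hN : G.IsPolarGauge N Q U) (hp : 1 < p) (hφ : ContDiff ℝ 1 φ)
    (hs : tsupport φ ⊆ U) (ε : ℝ) (x : Fin n → ℝ) :
    |truncRpow ε ((p - 2) / 2) (G.gradNorm N x ^ 2) * N x ^ (1 - p) *
        G.gradInner N (fun y => |φ y| ^ p) x| ≤ p * G.hardyPairing N p φ x := by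
  have hinner := abs_gradInner_le (G := G) N (fun y => |φ y| ^ p) x
  rw [gradNorm_abs_rpow hp (hφ.differentiable (by simp) x)] at hinner
  by_cases hx : x ∈ tsupport φ
  · have hNx : 0 < N x := hN.pos x (hs hx)
    have hgN : 0 ≤ G.gradNorm N x := gradNorm_nonneg N x
    have hgφ : 0 ≤ G.gradNorm φ x := gradNorm_nonneg φ x
    have hh : 0 ≤ truncRpow ε ((p - 2) / 2) (G.gradNorm N x ^ 2) :=
      truncRpow_nonneg (sq_nonneg _)
    have hpairing : G.hardyPairing N p φ x =
        G.gradNorm N x ^ (p - 1) * N x ^ (1 - p) * (|φ x| ^ (p - 1) * G.gradNorm φ x) := by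
      rw [hardyPairing, Real.mul_rpow (div_nonneg hgN hNx.le) (abs_nonneg _),
        Real.div_rpow hgN hNx.le, ← neg_sub p 1, Real.rpow_neg hNx.le]
      ring
    rw [abs_mul, abs_of_nonneg (mul_nonneg hh (Real.rpow_nonneg hNx.le _))]
    calc truncRpow ε ((p - 2) / 2) (G.gradNorm N x ^ 2) * N x ^ (1 - p) *
          |G.gradInner N (fun y => |φ y| ^ p) x|
        ≤ truncRpow ε ((p - 2) / 2) (G.gradNorm N x ^ 2) * N x ^ (1 - p) *
          (G.gradNorm N x * (p * (|φ x| ^ (p - 1) * G.gradNorm φ x))) := by gcongr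
      _ = p * (truncRpow ε ((p - 2) / 2) (G.gradNorm N x ^ 2) * G.gradNorm N x *
          N x ^ (1 - p) * (|φ x| ^ (p - 1) * G.gradNorm φ x)) := by ring
      _ ≤ p * G.hardyPairing N p φ x := by
          rw [hpairing]
          gcongr
          exact truncRpow_sq_mul_le hgN hp ε
  · rw [gradNorm_eq_zero_of_notMem_tsupport hx] at hinner
    have hzero : G.gradInner N (fun y => |φ y| ^ p) x = 0 := by simpa using hinner
    simp [hzero, hardyPairing, gradNorm_eq_zero_of_notMem_tsupport hx]

lemma integral_truncRpow_le (hN : G.IsPolarGauge N Q U) (hp : 1 < p) (hφ : ContDiff ℝ 1 φ)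
    (hc : HasCompactSupport φ) (hs : tsupport φ ⊆ U) {ε : ℝ} (hε : 0 < ε) :
    (Q - p) * ∫ x, truncRpow ε ((p - 2) / 2) (G.gradNorm N x ^ 2) * G.gradNorm N x ^ 2 /
        N x ^ p * |φ x| ^ p ≤ p * ∫ x, G.hardyPairing N p φ x := by
  have hsub := tsupport_abs_rpow_subset (one_pos.trans hp).ne' φ
  have hψ : ContDiff ℝ 1 fun x => |φ x| ^ p := hφ.norm_rpow hp
  rw [hN.integral_comp_gradNorm_sq_mul (contDiff_truncRpow hε) hψ
    (hc.of_isClosed_subset (isClosed_tsupport _) hsub) (hsub.trans hs), ← integral_const_mul]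
  refine (neg_le_abs _).trans ?_
  rw [← Real.norm_eq_abs]
  exact norm_integral_le_of_norm_le ((hN.integrable_hardyPairing hp hφ hc hs).const_mul p) <|
    .of_forall fun x => hN.abs_truncRpow_mul_gradInner_le hp hφ hs ε x

lemma integral_hardyWeight_le (hN : G.IsPolarGauge N Q U) (hp : 1 < p) (hφ : ContDiff ℝ 1 φ)
    (hc : HasCompactSupport φ) (hs : tsupport φ ⊆ U) :
    (Q - p) * ∫ x, G.gradNorm N x ^ p / N x ^ p * |φ x| ^ p ≤
      p * ∫ x, G.hardyPairing N p φ x := by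
  have hp0 : 0 < p := one_pos.trans hp
  have hsub := tsupport_abs_rpow_subset hp0.ne' φ
  have hlim : Tendsto (fun ε => ∫ x, truncRpow ε ((p - 2) / 2) (G.gradNorm N x ^ 2) *
      G.gradNorm N x ^ 2 / N x ^ p * |φ x| ^ p) (𝓝[>] 0)
      (𝓝 (∫ x, G.gradNorm N x ^ p / N x ^ p * |φ x| ^ p)) := by
    refine tendsto_integral_filter_of_dominated_convergence _ ?_
      (.of_forall fun ε => .of_forall fun x => ?_)
      (hN.integrable_hardyWeight hp0 hφ.continuous hc hs) (.of_forall fun x => ?_)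
    · filter_upwards [self_mem_nhdsWithin] with ε hε
      exact (hN.integrable_comp_gradNorm_sq_mul (contDiff_truncRpow hε) p
        (hφ.continuous.abs.rpow_const fun _ => Or.inr hp0.le)
        (hc.of_isClosed_subset (isClosed_tsupport _) hsub)
        (hsub.trans hs)).aestronglyMeasurable
    · by_cases hx : x ∈ tsupport φ
      · have hNx : 0 < N x := hN.pos x (hs hx)
        have hh := truncRpow_nonneg (ε := ε) (β := (p - 2) / 2) (sq_nonneg (G.gradNorm N x))
        rw [Real.norm_of_nonneg (by positivity)]
        gcongr
        exact truncRpow_sq_mul_sq_le (gradNorm_nonneg _ _) hp0 ε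
      · simp [image_eq_zero_of_notMem_tsupport hx, Real.zero_rpow hp0.ne']
    · exact ((tendsto_truncRpow_sq_mul_sq (gradNorm_nonneg _ _) hp0).div_const _).mul_const _
  refine le_of_tendsto (hlim.const_mul (Q - p)) ?_
  filter_upwards [self_mem_nhdsWithin] with ε hε
  exact hN.integral_truncRpow_le hp hφ hc hs hε

lemma hardyPairing_le (hN : G.IsPolarGauge N Q U) (hp : 1 < p) (hs : tsupport φ ⊆ U) {c : ℝ}
    (hc : 0 ≤ c) (x : Fin n → ℝ) :
    p * (c ^ (p - 1) * G.hardyPairing N p φ x) ≤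
      G.gradNorm φ x ^ p + (p - 1) * (c ^ p * (G.gradNorm N x ^ p / N x ^ p * |φ x| ^ p)) := by
  have hratio : 0 ≤ G.gradNorm N x / N x * |φ x| ∧ (G.gradNorm N x / N x * |φ x|) ^ p =
      G.gradNorm N x ^ p / N x ^ p * |φ x| ^ p := by
    have hgN : 0 ≤ G.gradNorm N x := gradNorm_nonneg N x
    by_cases hx : x ∈ tsupport φ
    · have hNx : 0 < N x := hN.pos x (hs hx)
      refine ⟨by positivity, ?_⟩
      rw [Real.mul_rpow (by positivity) (abs_nonneg _), Real.div_rpow hgN hNx.le]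
    · simp [image_eq_zero_of_notMem_tsupport hx, Real.zero_rpow (one_pos.trans hp).ne']
  have hyoung := mul_rpow_sub_one_mul_le hp (mul_nonneg hc hratio.1)
    (gradNorm_nonneg (G := G) φ x)
  rwa [Real.mul_rpow hc hratio.1, Real.mul_rpow hc hratio.1, hratio.2, _root_.mul_assoc] at hyoung

theorem hardy_inequality (hN : G.IsPolarGauge N Q U) (hp : 1 < p) (hpQ : p ≤ Q)
    (hφ : ContDiff ℝ 1 φ) (hc : HasCompactSupport φ) (hs : tsupport φ ⊆ U) :
    ((Q - p) / p) ^ p * ∫ x, G.gradNorm N x ^ p / N x ^ p * |φ x| ^ p ≤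
      ∫ x, G.gradNorm φ x ^ p := by
  have hp0 : 0 < p := one_pos.trans hp
  set c : ℝ := (Q - p) / p
  set A : ℝ := ∫ x, G.gradNorm N x ^ p / N x ^ p * |φ x| ^ p
  set B : ℝ := ∫ x, G.hardyPairing N p φ x
  set D : ℝ := ∫ x, G.gradNorm φ x ^ p
  have hc0 : 0 ≤ c := div_nonneg (sub_nonneg.2 hpQ) hp0.le
  have hgrad := integrable_gradNorm_rpow (G := G) hp0 hφ hc
  have hweight := (hN.integrable_hardyWeight hp0 hφ.continuous hc hs).const_mul (c ^ p)
  have hpairing := (hN.integrable_hardyPairing hp hφ hc hs).const_mul (c ^ (p - 1))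
  have hyoung : p * (c ^ (p - 1) * B) ≤ D + (p - 1) * (c ^ p * A) := by
    rw [← integral_const_mul, ← integral_const_mul, ← integral_const_mul, ← integral_const_mul,
      ← integral_add hgrad (hweight.const_mul _)]
    exact integral_mono (hpairing.const_mul p) (hgrad.add (hweight.const_mul _)) fun x =>
      hN.hardyPairing_le hp hs hc0 x
  have hweak : c * A ≤ B := by
    rw [div_mul_eq_mul_div, div_le_iff₀' hp0]
    exact hN.integral_hardyWeight_le hp hφ hc hs
  have hpow : c ^ p * A ≤ c ^ (p - 1) * B := by
    calc c ^ p * A = c ^ (p - 1) * (c * A) := by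
          rw [← _root_.mul_assoc, ← Real.rpow_add_one' hc0 (by linarith), sub_add_cancel]
      _ ≤ c ^ (p - 1) * B := by gcongr
  linarith [mul_le_mul_of_nonneg_left hpow hp0.le]

end IsPolarGauge

theorem IsFollandSolution.isPolarGauge_gauge {u : (Fin n → ℝ) → ℝ} (hu : G.IsFollandSolution u)
    (hQ : G.homDim ≠ 2) (hG : G.IsPolarizable) :
    G.IsPolarGauge (G.gauge u) G.homDim {0}ᶜ where
  isOpen := isOpen_compl_singleton
  smooth := (hu.isHomogeneousNorm_gauge hQ).smooth
  pos _ hx := (hu.isHomogeneousNorm_gauge hQ).pos hx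
  mul_subLaplacian _ hx := hu.gauge_mul_subLaplacian hQ hx
  infSubLaplacian_eq_zero := hG u hu

end CarnotGroup

/-! ### Polar coordinates -/

namespace CarnotGroup.IsHomogeneousNorm

variable {n : ℕ} {G : CarnotGroup n} {N : (Fin n → ℝ) → ℝ} {h : ℝ → ℝ} {c : ℝ}

lemma map_zero (hN : G.IsHomogeneousNorm N) : N 0 = 0 := (hN.eq_zero_iff 0).2 rfl

lemma eventuallyEq_comp (hN : G.IsHomogeneousNorm N) (hc : h =ᶠ[𝓝 0] fun _ => c) :
    (fun x => h (N x)) =ᶠ[𝓝 0] fun _ => c :=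
  (hN.continuous.tendsto' 0 0 hN.map_zero).eventually hc

lemma contDiff_comp (hN : G.IsHomogeneousNorm N) (hh : ContDiff ℝ ∞ h)
    (hc : h =ᶠ[𝓝 0] fun _ => c) : ContDiff ℝ ∞ fun x => h (N x) := by
  refine contDiff_iff_contDiffAt.2 fun x => ?_
  rcases eq_or_ne x 0 with rfl | hx
  · exact contDiffAt_const.congr_of_eventuallyEq (hN.eventuallyEq_comp hc)
  · exact hh.contDiffAt.comp x (hN.smooth.contDiffAt (isOpen_compl_singleton.mem_nhds hx))

lemma hasCompactSupport_comp (hN : G.IsHomogeneousNorm N) (hh : HasCompactSupport h) :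
    HasCompactSupport fun x => h (N x) :=
  (hN.isCompact_preimage hh).of_isClosed_subset (isClosed_tsupport _)
    (tsupport_comp_subset_preimage h hN.continuous)

lemma isPuncturedTestFunction_comp (hN : G.IsHomogeneousNorm N) (hh : ContDiff ℝ ∞ h)
    (hc : HasCompactSupport h) (h0 : 0 ∉ tsupport h) :
    IsPuncturedTestFunction fun x => h (N x) where
  smooth := hN.contDiff_comp hh (notMem_tsupport_iff_eventuallyEq.1 h0)
  compact := hN.hasCompactSupport_comp hc
  support x hx := by
    rintro rfl
    exact h0 (hN.map_zero ▸ tsupport_comp_subset_preimage h hN.continuous hx)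

-- Otherwise a cutoff function of `N` would be annihilated by every `X_j`.
lemma exists_gradNorm_ne_zero (hN : G.IsHomogeneousNorm N) {u : (Fin n → ℝ) → ℝ}
    (hu : G.IsFundamentalSolution u) : ∃ x ≠ 0, G.gradNorm N x ≠ 0 := by
  by_contra! hzero
  let χ : ContDiffBump (0 : ℝ) := ⟨1, 2, one_pos, one_lt_two⟩
  have hχ : χ =ᶠ[𝓝 0] fun _ => 1 := χ.eventuallyEq_one
  have hX (j : Fin n) (hj : j ∈ G.horizontal) (x : Fin n → ℝ) :
      G.X j (fun y => χ (N y)) x = 0 := by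
    rcases eq_or_ne x 0 with rfl | hx
    · rw [X_congr j (hN.eventuallyEq_comp hχ)]
      simp [X]
    · rw [X_comp j (χ.contDiff.differentiable one_ne_zero _).hasDerivAt (hN.differentiableAt hx),
        gradNorm_eq_zero_iff.1 (hzero x hx) j hj, MulZeroClass.mul_zero]
  have h0 := hu.eq_zero_of_X_eq_zero (hN.contDiff_comp χ.contDiff hχ)
    (hN.hasCompactSupport_comp χ.hasCompactSupport) hX
  rw [(hN.eventuallyEq_comp hχ).eq_of_nhds] at h0
  exact one_ne_zero h0

end CarnotGroup.IsHomogeneousNorm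

namespace CarnotGroup

variable {n : ℕ} {G : CarnotGroup n} {N w : (Fin n → ℝ) → ℝ}

lemma map_dilation_volume (G : CarnotGroup n) {r : ℝ} (hr : 0 < r) :
    (volume : Measure (Fin n → ℝ)).map (G.dilation r) =
      ENNReal.ofReal (r ^ G.homDim)⁻¹ • volume := by
  have hdet : (LinearMap.det (G.dilationCLM r : (Fin n → ℝ) →ₗ[ℝ] (Fin n → ℝ))) =
      r ^ G.homDim := by
    have hdiag : (G.dilationCLM r : (Fin n → ℝ) →ₗ[ℝ] (Fin n → ℝ)) =
        Matrix.toLin' (Matrix.diagonal fun i => r ^ G.weight i) := by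
      ext x i
      simp [dilationCLM, Matrix.mulVec_diagonal]
    rw [hdiag, LinearMap.det_toLin', Matrix.det_diagonal, homDim, Finset.prod_pow_eq_pow_sum]
  have hpos : 0 < r ^ G.homDim := pow_pos hr _
  rw [← abs_of_pos (inv_pos.2 hpos), ← hdet]
  exact Real.map_linearMap_volume_pi_eq_smul_volume_pi (hdet ▸ hpos.ne')

/-- Nonnegative densities `w` for which `w dx` is invariant under the dilations, that is, which are
homogeneous of degree `-Q`. As `w` need not extend continuously to `0`, its value there is fixed to
be `0`. -/
structure IsDilationInvariantDensity (G : CarnotGroup n) (w : (Fin n → ℝ) → ℝ) : Prop where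
  nonneg : ∀ x, 0 ≤ w x
  continuousOn : ContinuousOn w {0}ᶜ
  map_zero : w 0 = 0
  dilation : ∀ r > 0, ∀ x ≠ 0, w (G.dilation r x) = (r ^ G.homDim)⁻¹ * w x

/-- The image of the measure `w dx` under `log N`: the radial part of `w dx`, in logarithmic
coordinates. -/
noncomputable def logMeasure (N w : (Fin n → ℝ) → ℝ) : Measure ℝ :=
  (volume.withDensity fun x => ENNReal.ofReal (w x)).map fun x => Real.log (N x)

lemma IsHomogeneousNorm.measurable_log (hN : G.IsHomogeneousNorm N) :
    Measurable fun x => Real.log (N x) :=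
  Real.measurable_log.comp hN.continuous.measurable

namespace IsDilationInvariantDensity

lemma measurable_ofReal (hw : G.IsDilationInvariantDensity w) :
    Measurable fun x => ENNReal.ofReal (w x) :=
  (measurable_of_continuousOn_compl_singleton 0 hw.continuousOn).ennreal_ofReal

lemma ae_ne_zero (hw : G.IsDilationInvariantDensity w) :
    ∀ᵐ x ∂volume.withDensity fun x => ENNReal.ofReal (w x), x ≠ 0 := by
  refine (ae_withDensity_iff hw.measurable_ofReal).2 (.of_forall ?_)
  rintro _ hx rfl
  simp [hw.map_zero] at hx

lemma map_dilation_withDensity (hw : G.IsDilationInvariantDensity w) {r : ℝ} (hr : 0 < r) :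
    (volume.withDensity fun x => ENNReal.ofReal (w x)).map (G.dilation r) =
      volume.withDensity fun x => ENNReal.ofReal (w x) := by
  have hpos : 0 < r ^ G.homDim := pow_pos hr _
  have hmeas : Measurable (G.dilation r) := (G.continuous_dilation r).measurable
  have hw' (x : Fin n → ℝ) : ENNReal.ofReal (w x) =
      ENNReal.ofReal (r ^ G.homDim) * ENNReal.ofReal (w (G.dilation r x)) := by
    rcases eq_or_ne x 0 with rfl | hx
    · rw [show G.dilation r 0 = 0 from _root_.map_zero (G.dilationCLM r)]
      simp [hw.map_zero]
    · rw [← ENNReal.ofReal_mul hpos.le, hw.dilation r hr x hx, mul_inv_cancel_left₀ hpos.ne']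
  ext A hA
  rw [Measure.map_apply hmeas hA, withDensity_apply _ (hmeas hA), withDensity_apply _ hA]
  calc ∫⁻ x in G.dilation r ⁻¹' A, ENNReal.ofReal (w x)
      = ENNReal.ofReal (r ^ G.homDim) *
          ∫⁻ x in G.dilation r ⁻¹' A, ENNReal.ofReal (w (G.dilation r x)) := by
        rw [lintegral_congr hw']
        exact lintegral_const_mul _ (hw.measurable_ofReal.comp hmeas)
    _ = ENNReal.ofReal (r ^ G.homDim) * (ENNReal.ofReal (r ^ G.homDim)⁻¹ *
          ∫⁻ x in A, ENNReal.ofReal (w x)) := by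
        rw [← setLIntegral_map hA hw.measurable_ofReal hmeas, G.map_dilation_volume hr,
          Measure.restrict_smul, lintegral_smul_measure, smul_eq_mul]
    _ = ∫⁻ x in A, ENNReal.ofReal (w x) := by
        rw [← _root_.mul_assoc, ← ENNReal.ofReal_mul hpos.le, mul_inv_cancel₀ hpos.ne',
          ENNReal.ofReal_one, one_mul]

lemma isAddLeftInvariant_logMeasure (hw : G.IsDilationInvariantDensity w)
    (hN : G.IsHomogeneousNorm N) : (logMeasure N w).IsAddLeftInvariant where
  map_add_left_eq_self t := by
    have hlog : (fun x => t + Real.log (N x)) =ᵐ[volume.withDensity fun x => ENNReal.ofReal (w x)]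
        fun x => Real.log (N (G.dilation (Real.exp t) x)) := by
      filter_upwards [hw.ae_ne_zero] with x hx
      rw [hN.dilation _ (Real.exp_pos t), Real.log_mul (Real.exp_ne_zero t) (hN.pos hx).ne',
        Real.log_exp]
    calc (logMeasure N w).map (t + ·)
        = (volume.withDensity fun x => ENNReal.ofReal (w x)).map
            fun x => t + Real.log (N x) :=
          Measure.map_map (measurable_const_add t) hN.measurable_log
      _ = ((volume.withDensity fun x => ENNReal.ofReal (w x)).map
            (G.dilation (Real.exp t))).map fun x => Real.log (N x) := by
          rw [Measure.map_congr hlog]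
          exact (Measure.map_map hN.measurable_log (G.continuous_dilation _).measurable).symm
      _ = logMeasure N w := by rw [hw.map_dilation_withDensity (Real.exp_pos t), logMeasure]

lemma isFiniteMeasureOnCompacts_logMeasure (hw : G.IsDilationInvariantDensity w)
    (hN : G.IsHomogeneousNorm N) : IsFiniteMeasureOnCompacts (logMeasure N w) where
  lt_top_of_isCompact K hK := by
    have hshell : IsCompact (N ⁻¹' (Real.exp '' K)) :=
      hN.isCompact_preimage (hK.image Real.continuous_exp)
    have hne : N ⁻¹' (Real.exp '' K) ⊆ {0}ᶜ := by
      rintro _ ⟨t, -, ht⟩ rfl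
      exact (Real.exp_pos t).ne' (ht.trans hN.map_zero)
    have hsub : (fun x => Real.log (N x)) ⁻¹' K
        ≤ᵐ[volume.withDensity fun x => ENNReal.ofReal (w x)] N ⁻¹' (Real.exp '' K) := by
      filter_upwards [hw.ae_ne_zero] with x hx hxK
      exact ⟨_, hxK, Real.exp_log (hN.pos hx)⟩
    rw [logMeasure, Measure.map_apply hN.measurable_log hK.measurableSet]
    refine (measure_mono_ae hsub).trans_lt ?_
    rw [withDensity_apply _ hshell.measurableSet]
    exact ((hw.continuousOn.mono hne).integrableOn_compact hshell).lintegral_lt_top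

lemma logMeasure_ne_zero (hw : G.IsDilationInvariantDensity w) (hN : G.IsHomogeneousNorm N)
    {x : Fin n → ℝ} (hx : x ≠ 0) (hwx : w x ≠ 0) : logMeasure N w ≠ 0 := fun hzero => by
  rw [logMeasure, Measure.map_eq_zero_iff hN.measurable_log.aemeasurable,
    withDensity_eq_zero_iff hw.measurable_ofReal.aemeasurable] at hzero
  refine hwx <| Measure.eqOn_open_of_ae_eq (μ := volume) (g := 0) (ae_restrict_of_ae ?_)
    isOpen_compl_singleton hw.continuousOn continuousOn_const hx
  filter_upwards [hzero] with y hy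
  exact (ENNReal.ofReal_eq_zero.1 hy).antisymm (hw.nonneg y)

lemma exists_integral_mul_comp_log (hw : G.IsDilationInvariantDensity w)
    (hN : G.IsHomogeneousNorm N) {x : Fin n → ℝ} (hx : x ≠ 0) (hwx : w x ≠ 0) :
    ∃ c > 0, ∀ F : ℝ → ℝ, Measurable F →
      ∫ x, w x * F (Real.log (N x)) = c * ∫ t, F t := by
  have := hw.isAddLeftInvariant_logMeasure hN
  have := hw.isFiniteMeasureOnCompacts_logMeasure hN
  have hhaar := Measure.isAddLeftInvariant_eq_smul (logMeasure N w) volume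
  set c := Measure.addHaarScalarFactor (logMeasure N w) volume
  refine ⟨c, NNReal.coe_pos.2 (pos_iff_ne_zero.2 fun hc => ?_), fun F hF => ?_⟩
  · rw [hc, zero_smul] at hhaar
    exact hw.logMeasure_ne_zero hN hx hwx hhaar
  · calc ∫ x, w x * F (Real.log (N x))
        = ∫ x, F (Real.log (N x)) ∂volume.withDensity fun x => ENNReal.ofReal (w x) := by
          rw [integral_withDensity_eq_integral_toReal_smul hw.measurable_ofReal
            (.of_forall fun _ => ENNReal.ofReal_lt_top)]
          simp only [ENNReal.toReal_ofReal (hw.nonneg _), smul_eq_mul]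
      _ = ∫ t, F t ∂logMeasure N w :=
          (integral_map hN.measurable_log.aemeasurable hF.aestronglyMeasurable).symm
      _ = c * ∫ t, F t := by
          rw [hhaar, integral_smul_nnreal_measure, NNReal.smul_def, smul_eq_mul]

end IsDilationInvariantDensity

lemma IsHomogeneousNorm.isDilationInvariantDensity (hN : G.IsHomogeneousNorm N)
    (hQ : G.homDim ≠ 0) {p : ℝ} (hp : 0 ≤ p) :
    G.IsDilationInvariantDensity fun x => G.gradNorm N x ^ p * N x ^ (-(G.homDim : ℝ)) where
  nonneg x := mul_nonneg (Real.rpow_nonneg (gradNorm_nonneg _ _) _)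
    (Real.rpow_nonneg (hN.nonneg x) _)
  continuousOn := ((continuousOn_gradNorm isOpen_compl_singleton hN.smooth).rpow_const
    fun _ _ => Or.inr hp).mul <|
    hN.continuous.continuousOn.rpow_const fun x hx => Or.inl (hN.pos hx).ne'
  map_zero := by
    rw [hN.map_zero, Real.zero_rpow (neg_ne_zero.2 (Nat.cast_ne_zero.2 hQ)), MulZeroClass.mul_zero]
  dilation r hr x hx := by
    rw [hN.gradNorm_dilation hr hx, hN.dilation r hr, Real.mul_rpow hr.le (hN.nonneg x),
      Real.rpow_neg hr.le, Real.rpow_natCast]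
    ring

end CarnotGroup

/-! ### Sharpness -/

/-- The function `s ↦ s^{-a} g(log s)` of the radial variable corresponding to the function `g` of
the logarithmic variable. -/
noncomputable def logProfile (a : ℝ) (g : ℝ → ℝ) (s : ℝ) : ℝ := s ^ (-a) * g (Real.log s)

section LogProfile

variable {a s : ℝ} {g : ℝ → ℝ}

lemma contDiffAt_logProfile (hg : ContDiff ℝ ∞ g) (hs : s ≠ 0) :
    ContDiffAt ℝ ∞ (logProfile a g) s :=
  (Real.contDiffAt_rpow_const_of_ne hs).mul (hg.contDiffAt.comp s (Real.contDiffAt_log.2 hs))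

lemma hasDerivAt_logProfile (hg : Differentiable ℝ g) (hs : 0 < s) :
    HasDerivAt (logProfile a g) (s ^ (-a - 1) * (deriv g (Real.log s) - a * g (Real.log s))) s := by
  refine ((Real.hasDerivAt_rpow_const (Or.inl hs.ne')).mul
    ((hg _).hasDerivAt.comp s (Real.hasDerivAt_log hs.ne'))).congr_deriv ?_
  rw [Function.comp_apply, Real.rpow_sub_one hs.ne']
  field_simp
  ring

lemma tsupport_logProfile_subset (ha : a ≠ 0) (hc : HasCompactSupport g) :
    tsupport (logProfile a g) ⊆
      Real.exp '' tsupport g ∪ (fun t => -Real.exp t) '' tsupport g := by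
  refine closure_minimal (fun s hs => ?_)
    ((hc.image Real.continuous_exp).union (hc.image Real.continuous_exp.neg)).isClosed
  have hs0 : s ≠ 0 := by
    rintro rfl
    simp [logProfile, Real.zero_rpow (neg_ne_zero.2 ha)] at hs
  have hlog : Real.log s ∈ tsupport g := subset_tsupport g (right_ne_zero_of_mul hs)
  rcases hs0.lt_or_gt with hneg | hpos
  · exact Or.inr ⟨_, hlog, by simp [Real.exp_log_of_neg hneg]⟩
  · exact Or.inl ⟨_, hlog, Real.exp_log hpos⟩

lemma zero_notMem_tsupport_logProfile (ha : a ≠ 0) (hc : HasCompactSupport g) :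
    0 ∉ tsupport (logProfile a g) := fun h => by
  rcases tsupport_logProfile_subset ha hc h with ⟨t, -, ht⟩ | ⟨t, -, ht⟩
  · exact (Real.exp_pos t).ne' ht
  · exact (Real.exp_pos t).ne' (neg_eq_zero.1 ht)

lemma hasCompactSupport_logProfile (ha : a ≠ 0) (hc : HasCompactSupport g) :
    HasCompactSupport (logProfile a g) :=
  ((hc.image Real.continuous_exp).union (hc.image Real.continuous_exp.neg)).of_isClosed_subset
    (isClosed_tsupport _) (tsupport_logProfile_subset ha hc)

lemma contDiff_logProfile (ha : a ≠ 0) (hg : ContDiff ℝ ∞ g) (hc : HasCompactSupport g) :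
    ContDiff ℝ ∞ (logProfile a g) := by
  refine contDiff_iff_contDiffAt.2 fun s => ?_
  rcases eq_or_ne s 0 with rfl | hs
  · exact (contDiffAt_const (c := (0 : ℝ))).congr_of_eventuallyEq
      (notMem_tsupport_iff_eventuallyEq.1 (zero_notMem_tsupport_logProfile ha hc))
  · exact contDiffAt_logProfile hg hs

end LogProfile

section OneDimensional

variable {a p C : ℝ} {g : ℝ → ℝ}

lemma tendsto_integral_abs_mul_deriv_sub (hp : 0 < p) (hg : ContDiff ℝ 1 g)
    (hc : HasCompactSupport g) :
    Tendsto (fun ε => ∫ t, |ε * deriv g t - a * g t| ^ p) (𝓝 0) (𝓝 (∫ t, |a * g t| ^ p)) := by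
  have hd : Continuous (deriv g) := hg.continuous_deriv le_rfl
  have hcont : Continuous g := hg.continuous
  have hintegrand : Continuous fun z : ℝ × ℝ => |z.1 * deriv g z.2 - a * g z.2| ^ p :=
    Continuous.rpow_const (by fun_prop) fun _ => Or.inr hp.le
  have hcts : ContinuousOn (fun ε => ∫ t, |ε * deriv g t - a * g t| ^ p) univ := by
    refine continuousOn_integral_of_compact_support hc hintegrand.continuousOn fun ε t _ ht => ?_
    have hderiv : deriv g t = 0 :=
      image_eq_zero_of_notMem_tsupport fun h => ht (tsupport_deriv_subset h)
    simp [hderiv, image_eq_zero_of_notMem_tsupport ht, Real.zero_rpow hp.ne']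
  simpa using (continuousOn_univ.1 hcts).tendsto 0

lemma le_abs_rpow_of_forall_integral_le (hp : 0 < p)
    (h : ∀ g : ℝ → ℝ, ContDiff ℝ ∞ g → HasCompactSupport g →
      C * ∫ t, |g t| ^ p ≤ ∫ t, |deriv g t - a * g t| ^ p) : C ≤ |a| ^ p := by
  let χ : ContDiffBump (0 : ℝ) := ⟨1, 2, one_pos, one_lt_two⟩
  have hstretch (ε : ℝ) (hε : 0 < ε) :
      C * ∫ t, |χ t| ^ p ≤ ∫ t, |ε * deriv χ t - a * χ t| ^ p := by
    have hχε := h (fun t => χ (ε * t)) (χ.contDiff.comp (by fun_prop))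
      (χ.hasCompactSupport.comp_homeomorph (Homeomorph.mulLeft₀ ε hε.ne'))
    simp only [deriv_comp_mul_left, smul_eq_mul] at hχε
    rw [Measure.integral_comp_mul_left (fun t => |χ t| ^ p),
      Measure.integral_comp_mul_left (fun t => |ε * deriv χ t - a * χ t| ^ p), smul_eq_mul,
      smul_eq_mul, mul_left_comm] at hχε
    exact le_of_mul_le_mul_left hχε (abs_pos.2 (inv_ne_zero hε.ne'))
  have hlim : C * ∫ t, |χ t| ^ p ≤ ∫ t, |a * χ t| ^ p := by
    have htendsto := tendsto_integral_abs_mul_deriv_sub (a := a) hp χ.contDiff χ.hasCompactSupport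
    refine ge_of_tendsto (htendsto.mono_left (nhdsWithin_le_nhds (s := Ioi 0))) ?_
    filter_upwards [self_mem_nhdsWithin] with ε hε using hstretch ε hε
  have hpos : 0 < ∫ t, |χ t| ^ p := by
    refine (χ.continuous.abs.rpow_const
      fun _ => Or.inr hp.le).integral_pos_of_hasCompactSupport_nonneg_nonzero (x := 0)
      (χ.hasCompactSupport.comp_left (g := fun t : ℝ => |t| ^ p) (by simp [Real.zero_rpow hp.ne']))
      (fun t => by positivity) ?_
    simp [χ.eventuallyEq_one.eq_of_nhds]
  refine le_of_mul_le_mul_right (hlim.trans_eq ?_) hpos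
  simp only [abs_mul, Real.mul_rpow (abs_nonneg _) (abs_nonneg _), integral_const_mul]

end OneDimensional

namespace CarnotGroup.IsHomogeneousNorm

variable {n : ℕ} {G : CarnotGroup n} {N : (Fin n → ℝ) → ℝ} {a p : ℝ} {g : ℝ → ℝ}
  {x : Fin n → ℝ}

lemma gradNorm_logProfile_rpow (hN : G.IsHomogeneousNorm N) (hg : Differentiable ℝ g)
    (hap : (a + 1) * p = G.homDim) (hx : x ≠ 0) :
    G.gradNorm (fun y => logProfile a g (N y)) x ^ p =
      G.gradNorm N x ^ p * N x ^ (-(G.homDim : ℝ)) *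
        |deriv g (Real.log (N x)) - a * g (Real.log (N x))| ^ p := by
  have hNx : 0 ≤ N x := hN.nonneg x
  rw [gradNorm_comp (hasDerivAt_logProfile hg (hN.pos hx)) (hN.differentiableAt hx), abs_mul,
    abs_of_nonneg (Real.rpow_nonneg hNx _), Real.mul_rpow (by positivity) (gradNorm_nonneg _ _),
    Real.mul_rpow (by positivity) (abs_nonneg _), ← Real.rpow_mul hNx,
    show (-a - 1) * p = -(G.homDim : ℝ) by rw [← hap]; ring]
  ring

lemma hardyWeight_mul_logProfile_rpow (hN : G.IsHomogeneousNorm N)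
    (hap : (a + 1) * p = G.homDim) (hx : x ≠ 0) :
    G.gradNorm N x ^ p / N x ^ p * |logProfile a g (N x)| ^ p =
      G.gradNorm N x ^ p * N x ^ (-(G.homDim : ℝ)) * |g (Real.log (N x))| ^ p := by
  have hNx : 0 < N x := hN.pos hx
  rw [logProfile, abs_mul, abs_of_nonneg (Real.rpow_nonneg hNx.le _),
    Real.mul_rpow (by positivity) (abs_nonneg _), ← Real.rpow_mul hNx.le,
    show -(G.homDim : ℝ) = -p + -a * p by rw [← hap]; ring, Real.rpow_add hNx,
    Real.rpow_neg hNx.le p]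
  ring

theorem le_of_forall_hardy (hN : G.IsHomogeneousNorm N) (hx : x ≠ 0) (hgrad : G.gradNorm N x ≠ 0)
    (hp : 0 < p) (hpQ : p < G.homDim) {C : ℝ}
    (hC : ∀ φ : (Fin n → ℝ) → ℝ, IsPuncturedTestFunction φ →
      C * ∫ x, G.gradNorm N x ^ p / N x ^ p * |φ x| ^ p ≤ ∫ x, G.gradNorm φ x ^ p) :
    C ≤ (((G.homDim : ℝ) - p) / p) ^ p := by
  have hQ : G.homDim ≠ 0 := by exact_mod_cast (hp.trans hpQ).ne'
  set a : ℝ := ((G.homDim : ℝ) - p) / p with ha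
  have ha0 : 0 < a := div_pos (sub_pos.2 hpQ) hp
  have hap : (a + 1) * p = G.homDim := by rw [ha]; field_simp; ring
  have hx' : G.gradNorm N x ^ p * N x ^ (-(G.homDim : ℝ)) ≠ 0 :=
    mul_ne_zero ((Real.rpow_ne_zero (gradNorm_nonneg _ _) hp.ne').2 hgrad)
      (Real.rpow_pos_of_pos (hN.pos hx) _).ne'
  obtain ⟨c, hc0, hpolar⟩ :=
    (hN.isDilationInvariantDensity hQ hp.le).exists_integral_mul_comp_log hN hx hx'
  have hnontrivial : Nontrivial (Fin n → ℝ) := ⟨x, 0, hx⟩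
  have hne : ∀ᵐ y : Fin n → ℝ, y ≠ 0 := Measure.ae_ne volume 0
  rw [← abs_of_pos ha0]
  refine le_abs_rpow_of_forall_integral_le hp fun g hg hgc => ?_
  have htest := hC _ <| hN.isPuncturedTestFunction_comp (contDiff_logProfile ha0.ne' hg hgc)
    (hasCompactSupport_logProfile ha0.ne' hgc) (zero_notMem_tsupport_logProfile ha0.ne' hgc)
  have hgd : Continuous (deriv g) := hg.continuous_deriv (by simp)
  have hgcont := hg.continuous
  have hweight : ∫ x, G.gradNorm N x ^ p / N x ^ p * |logProfile a g (N x)| ^ p =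
      c * ∫ t, |g t| ^ p := by
    rw [← hpolar _ (by fun_prop)]
    exact integral_congr_ae (hne.mono fun x hx => hN.hardyWeight_mul_logProfile_rpow hap hx)
  have henergy : ∫ x, G.gradNorm (fun y => logProfile a g (N y)) x ^ p =
      c * ∫ t, |deriv g t - a * g t| ^ p := by
    rw [← hpolar _ (by fun_prop)]
    exact integral_congr_ae (hne.mono fun x hx =>
      hN.gradNorm_logProfile_rpow (hg.differentiable (by simp)) hap hx)
  rw [hweight, henergy, mul_left_comm] at htest
  exact le_of_mul_le_mul_left htest hc0

end CarnotGroup.IsHomogeneousNorm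

theorem theorem3p1 {n : ℕ} (G : CarnotGroup n) (hQ : 3 ≤ G.homDim) (hG : G.IsPolarizable)
    (u : (Fin n → ℝ) → ℝ) (hu : G.IsFollandSolution u)
    (p : ℝ) (hp1 : 1 < p) (hpQ : p < G.homDim) :
    (∀ φ : (Fin n → ℝ) → ℝ, IsPuncturedTestFunction φ →
      Integrable (fun x => G.gradNorm φ x ^ p) ∧
      Integrable (fun x => G.gradNorm (G.gauge u) x ^ p / G.gauge u x ^ p * |φ x| ^ p) ∧
      (((G.homDim : ℝ) - p) / p) ^ p *
          ∫ x, G.gradNorm (G.gauge u) x ^ p / G.gauge u x ^ p * |φ x| ^ p ≤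
        ∫ x, G.gradNorm φ x ^ p) ∧
    (∀ C : ℝ,
      (∀ φ : (Fin n → ℝ) → ℝ, IsPuncturedTestFunction φ →
        C * ∫ x, G.gradNorm (G.gauge u) x ^ p / G.gauge u x ^ p * |φ x| ^ p ≤
          ∫ x, G.gradNorm φ x ^ p) →
      C ≤ (((G.homDim : ℝ) - p) / p) ^ p) := by
  have hp0 : 0 < p := one_pos.trans hp1
  have hQ2 : G.homDim ≠ 2 := by omega
  have hpolar := hu.isPolarGauge_gauge hQ2 hG
  have hnorm := hu.isHomogeneousNorm_gauge hQ2
  refine ⟨fun φ hφ => ?_, fun C hC => ?_⟩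
  · have hφ1 : ContDiff ℝ 1 φ := hφ.smooth.of_le (by simp)
    exact ⟨G.integrable_gradNorm_rpow hp0 hφ1 hφ.compact,
      hpolar.integrable_hardyWeight hp0 hφ1.continuous hφ.compact hφ.support,
      hpolar.hardy_inequality hp1 hpQ.le hφ1 hφ.compact hφ.support⟩
  · obtain ⟨x, hx, hgrad⟩ := hnorm.exists_gradNorm_ne_zero hu.fundamental
    exact hnorm.le_of_forall_hardy hx hgrad hp0 hpQ hC
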